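/- **Setting.** There are $n\ge 1$ bidders and $k\ge 1$ items. A valuation profile is $v=(v_{ij})$ with $v_{ij}\ge 0$; valuations are additive. A single good is sold to bidders with values $b_1,\dots,b_n$ at prices $q_1,\dots,q_n\ge 0$ by one of two rules. *Posted prices*: among the bidders with $b_i\ge q_i$, one with the highest price $q_i$ gets the good and pays $q_i$ (prices are offered in decreasing order). *Second price with reserves*: the highest bidder $i$ gets the good if $b_i\ge q_i$, and pays $\max(q_i,\max_{i'\neq i}b_{i'})$. Ties go to the lowest index. *Grand-bundle pricing* sells all items together, as one good with $b_i=\sum_j v_{ij}$ and prices $p_i$; *item pricing* sells each item $j$ separately, with $b_i=v_{ij}$ and prices $p_{ij}$. In the *anonymous* versions the prices do not depend on $i$. *Best of both* is the union of the grand-bundle class and the item class (both anonymous or both non-anonymous). Write $r(h,v)$ for the revenue (sum of payments) of auction $h$ on profile $v$, and $R_D(h)=\mathbb E_{v\sim D}[r(h,v)]$. An auction is identified with its prices. An *ERM process* for a class $H$ maps every non-empty finite sample $T$ (a multiset of profiles) to some $h_T\in H$ that maximizes $\frac1{|T|}\sum_{v\in T}r(h,v)$ over $h\in H$; ties are broken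 by a fixed rule which favors prices that are sample values: anonymous bundle prices of the form $\sum_j v_{ij}$ with $v\in T$ and some bidder $i$; non-anonymous bundle prices $p_i=\sum_j v_{ij}$ with $v\in T$; anonymous item prices $p_j=v_{ij}$ with $v\in T$ and some $i$; non-anonymous item prices $p_{ij}=v_{ij}$ with $v\in T$. Its *split-sample growth rate* is $$\hat\tau_H(m)=\sup_{|S|=m}\bigl|\{h_T: T\subseteq S,\ |T|=\lceil m/2\rceil\}\bigr|.$$ Its *sample complexity* $m_H(\epsilon)$ is the smallest $m_0$ such that for all $m\ge m_0$ and all distributions $D$ on profiles for which the revenue of every auction of $H$ lies in $[0,1]$, $\mathbb E_{S\sim D^m}[R_D(h_S)]\ge\sup_{h\in H}R_D(h)-\epsilon$. **Theorem.** For either rule of sale: 1. In each of the six classes, on every non-empty sample some empirical revenue maximizer has all its prices among the sample values, and hence so does the output of every ERM process. 2. For every ERM process and all $m\ge 1$: $\hat\tau_H(m)\le mn$ (anonymous grand bundle), $m^n$ (non-anonymous grand bundle), $(nm)^k$ (anonymous item pricing), $m^{nk}$ (non-anonymous item pricing), $(mn)^{k+1}$ (anonymous best of both), $m^{n(k+1)}$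 (non-anonymous best of both). 3. There is a universal constant $C$ such that for all $n,k\ge1$, $0<\epsilon\le 1/2$ and every ERM process, $m_H(\epsilon)$ is at most $C\,\frac{n\log(1/\epsilon)}{\epsilon^2}$ for grand-bundle pricing, $C\,\frac{nk\log(1/\epsilon)}{\epsilon^2}$ for item pricing, and $C\,\frac{n(k+1)\log(1/\epsilon)}{\epsilon^2}$ for best of both, each in the anonymous and in the non-anonymous version. 4. Let $n=1$, let $H$ be a best-of-both class and let $D$ be a distribution with independent item values for which the revenue of every auction of $H$ lies in $[0,1]$. Then for every ERM process for $H$ and all $m\ge1$, $$\mathbb E_{S\sim D^m}[R_D(h_S)]\ \ge\ \frac16\sup_{M}R_D(M)-\sqrt{\frac{2(k+1)\log(2m)}{m}},$$ where $M$ ranges over all truthful (incentive compatible and individually rational, possibly randomized) mechanisms. -/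

import Mathlib

open MeasureTheory ProbabilityTheory
open scoped NNReal ENNReal

namespace SplitSample

noncomputable section

/-! ### Mechanisms for `n` additive bidders and `k` items -/

/-- A valuation profile: `v i j` is the value of bidder `i` for item `j`. -/
abbrev Profile (n k : ℕ) : Type := Fin n → Fin k → ℝ≥0

/-- A direct (possibly randomized) mechanism: on reports `v`, bidder `i` receives item `j` with
probability `alloc v i j` and pays `pay v i` (in expectation over the mechanism's coins). -/
structure Mechanism (n k : ℕ) where
  alloc : Profile n k → Fin n → Fin k → ℝ
  pay : Profile n k → Fin n → ℝ

namespace Mechanism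

variable {n k : ℕ}

/-- Revenue on a profile: the sum of the payments. -/
def revenue (M : Mechanism n k) (v : Profile n k) : ℝ := ∑ i, M.pay v i

/-- Expected revenue under the value distribution `D`. -/
def expRevenue (M : Mechanism n k) (D : Measure (Profile n k)) : ℝ := ∫ v, M.revenue v ∂D

/-- Utility of bidder `i` with (additive) item values `w` when the reported profile is `v`. -/
def utility (M : Mechanism n k) (i : Fin n) (w : Fin k → ℝ≥0) (v : Profile n k) : ℝ :=
  ∑ j, (w j : ℝ) * M.alloc v i j - M.pay v i

/-- Dominant-strategy truthful mechanisms: every item is allocated at most once, no bidder ever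
gains by misreporting, and truthful participation never gives negative utility. -/
structure IsTruthful (M : Mechanism n k) : Prop where
  alloc_nonneg : ∀ v i j, 0 ≤ M.alloc v i j
  alloc_le_one : ∀ v j, ∑ i, M.alloc v i j ≤ 1
  incentive_compatible : ∀ (v : Profile n k) (i : Fin n) (w' : Fin k → ℝ≥0),
    M.utility i (v i) (Function.update v i w') ≤ M.utility i (v i) v
  individually_rational : ∀ (v : Profile n k) (i : Fin n), 0 ≤ M.utility i (v i) v

end Mechanism

/-! ### Selling one good with a price (reserve) for each bidder -/

/-- How one good (an item or the grand bundle) is sold, given a price for each bidder.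
`postedPrice`: take-it-or-leave-it prices, offered in decreasing order of price.
`secondPrice`: second-price auction in which the prices are (bidder-specific) reserves. -/
inductive SaleRule
  | postedPrice
  | secondPrice

variable {n k : ℕ}

/-- Bidder `i` gets the good, at prices `q` and bids `b`. Under both rules `i` must meet her own
price; she must moreover have the highest price among the bidders who meet theirs (posted prices),
or the highest bid (second-price auction). Ties go to the lowest index. -/
def SaleRule.wins (rule : SaleRule) (q b : Fin n → ℝ≥0) (i : Fin n) : Prop :=
  match rule with
  | .postedPrice => q i ≤ b i ∧ ∀ i', q i' ≤ b i' → q i' < q i ∨ (q i' = q i ∧ i ≤ i')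
  | .secondPrice => q i ≤ b i ∧ ∀ i', b i' < b i ∨ (b i' = b i ∧ i ≤ i')

/-- What bidder `i` pays when she gets the good: her price, respectively the larger of her price
and the highest competing bid. -/
def SaleRule.charge (rule : SaleRule) (q b : Fin n → ℝ≥0) (i : Fin n) : ℝ≥0 :=
  match rule with
  | .postedPrice => q i
  | .secondPrice => max (q i) ((Finset.univ.erase i).sup b)

open Classical in
/-- Sell all items as one grand bundle; `q i` is the price of the bundle for bidder `i`. -/
def bundleMechanism (rule : SaleRule) (q : Fin n → ℝ≥0) : Mechanism n k where
  alloc v i _ := if rule.wins q (fun i' => ∑ j, v i' j) i then 1 else 0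
  pay v i := if rule.wins q (fun i' => ∑ j, v i' j) i then
    (rule.charge q (fun i' => ∑ j, v i' j) i : ℝ) else 0

open Classical in
/-- Sell every item separately; `q i j` is the price of item `j` for bidder `i`. -/
def itemMechanism (rule : SaleRule) (q : Fin n → Fin k → ℝ≥0) : Mechanism n k where
  alloc v i j := if rule.wins (fun i' => q i' j) (fun i' => v i' j) i then 1 else 0
  pay v i := ∑ j, if rule.wins (fun i' => q i' j) (fun i' => v i' j) i then
    (rule.charge (fun i' => q i' j) (fun i' => v i' j) i : ℝ) else 0

/-! ### Parametrized auction classes -/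

/-- A parametrized class of auctions, together with, for every sample `T`, the set of those
parameters whose prices are values that occur in `T`. -/
structure AuctionClass (n k : ℕ) where
  Hyp : Type
  mech : Hyp → Mechanism n k
  onSample : Multiset (Profile n k) → Set Hyp

/-- Grand-bundle pricing with one price for all bidders. -/
def anonymousBundlePricing (rule : SaleRule) (n k : ℕ) : AuctionClass n k where
  Hyp := ℝ≥0
  mech p := bundleMechanism rule (fun _ => p)
  onSample T := {p | ∃ v ∈ T, ∃ i, p = ∑ j, v i j}

/-- Grand-bundle pricing with a price for each bidder. -/
def bundlePricing (rule : SaleRule) (n k : ℕ) : AuctionClass n k where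
  Hyp := Fin n → ℝ≥0
  mech p := bundleMechanism rule p
  onSample T := {p | ∀ i, ∃ v ∈ T, p i = ∑ j, v i j}

/-- Item pricing with one price per item for all bidders. -/
def anonymousItemPricing (rule : SaleRule) (n k : ℕ) : AuctionClass n k where
  Hyp := Fin k → ℝ≥0
  mech p := itemMechanism rule (fun _ => p)
  onSample T := {p | ∀ j, ∃ v ∈ T, ∃ i, p j = v i j}

/-- Item pricing with a price for each bidder and item. -/
def itemPricing (rule : SaleRule) (n k : ℕ) : AuctionClass n k where
  Hyp := Fin n → Fin k → ℝ≥0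
  mech p := itemMechanism rule p
  onSample T := {p | ∀ i j, ∃ v ∈ T, p i j = v i j}

/-- The union of two classes: use an auction of the one or of the other. -/
def bestOf (A B : AuctionClass n k) : AuctionClass n k where
  Hyp := A.Hyp ⊕ B.Hyp
  mech := Sum.elim A.mech B.mech
  onSample T := Sum.inl '' A.onSample T ∪ Sum.inr '' B.onSample T

/-- Best of anonymous grand-bundle pricing and anonymous item pricing. -/
def anonymousBestPricing (rule : SaleRule) (n k : ℕ) : AuctionClass n k :=
  bestOf (anonymousBundlePricing rule n k) (anonymousItemPricing rule n k)

/-- Best of non-anonymous grand-bundle pricing and non-anonymous item pricing. -/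
def bestPricing (rule : SaleRule) (n k : ℕ) : AuctionClass n k :=
  bestOf (bundlePricing rule n k) (itemPricing rule n k)

/-! ### Empirical revenue maximization, split-sample growth, sample complexity -/

/-- The split-sample hypothesis space of a sample `S`: the outputs of the process `erm` on the
sub-samples of `S` of size `⌈|S| / 2⌉`. Samples are finite multisets. -/
def splitSampleSpace {Z H : Type} (erm : Multiset Z → H) (S : Multiset Z) : Set H :=
  {h | ∃ T ≤ S, T.card = (S.card + 1) / 2 ∧ h = erm T}

/-- The split-sample growth rate at `m`. -/
def splitSampleGrowth {Z H : Type} (erm : Multiset Z → H) (m : ℕ) : ℕ∞ :=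
  ⨆ (S : Multiset Z) (_ : S.card = m), (splitSampleSpace erm S).encard

namespace AuctionClass

/-- Average revenue on the sample `T`. -/
def empRevenue (A : AuctionClass n k) (T : Multiset (Profile n k)) (h : A.Hyp) : ℝ :=
  (T.map (fun v => (A.mech h).revenue v)).sum / T.card

/-- `h` maximizes the empirical revenue on `T` over the class. -/
def IsMaximizer (A : AuctionClass n k) (T : Multiset (Profile n k)) (h : A.Hyp) : Prop :=
  ∀ h', A.empRevenue T h' ≤ A.empRevenue T h

/-- Empirical revenue maximization with a fixed rule that breaks ties in favour of prices that are
values in the sample (if there are such prices among the maximizers). -/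
structure IsERM (A : AuctionClass n k) (erm : Multiset (Profile n k) → A.Hyp) : Prop where
  isMaximizer : ∀ T ≠ 0, A.IsMaximizer T (erm T)
  favors_sample : ∀ T ≠ 0, (∃ h ∈ A.onSample T, A.IsMaximizer T h) → erm T ∈ A.onSample T

/-- Best expected revenue of the class under `D`. -/
def optRevenue (A : AuctionClass n k) (D : Measure (Profile n k)) : ℝ :=
  ⨆ h : A.Hyp, (A.mech h).expRevenue D

/-- Expected revenue under `D` of the auction that `erm` picks from `m` independent draws from `D`.
The integrand is nonnegative; `∫⁻` is the lower integral, so that lower bounds on this quantity are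
meaningful without measurability of the tie-breaking, and it is the expectation when the integrand
is measurable. -/
def learnedRevenue (A : AuctionClass n k) (erm : Multiset (Profile n k) → A.Hyp)
    (D : Measure (Profile n k)) (m : ℕ) : ℝ≥0∞ :=
  ∫⁻ s : Fin m → Profile n k,
    ENNReal.ofReal ((A.mech (erm (Finset.univ.val.map s))).expRevenue D) ∂Measure.pi (fun _ => D)

/-- The distributions for which the revenue of every auction of the class lies in `[0, 1]`. -/
def unitRevenue (A : AuctionClass n k) : Set (ProbabilityMeasure (Profile n k)) :=
  {D | ∀ᵐ v ∂(D : Measure (Profile n k)), ∀ h : A.Hyp, (A.mech h).revenue v ∈ Set.Icc 0 1}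

/-- Additive-error sample complexity of the class with the learning rule `erm`, over a set `𝒟` of
distributions: the smallest `m₀` such that, for all `m ≥ m₀` and all `D ∈ 𝒟`, `m` samples suffice
for expected revenue within `ε` of the best in the class (`⊤` if there is no such `m₀`). -/
def sampleComplexity (A : AuctionClass n k) (erm : Multiset (Profile n k) → A.Hyp)
    (𝒟 : Set (ProbabilityMeasure (Profile n k))) (ε : ℝ) : ℕ∞ :=
  sInf {x | ∃ m₀ : ℕ, x = m₀ ∧ ∀ m ≥ m₀, ∀ D ∈ 𝒟,
    ENNReal.ofReal (A.optRevenue D) ≤ A.learnedRevenue erm D m + ENNReal.ofReal ε}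

/-- Some empirical revenue maximizer has all its prices among the sample values, hence so does
every output of an ERM process that favours sample values. -/
def ERMOnSample (A : AuctionClass n k) : Prop :=
  (∀ T ≠ 0, ∃ h ∈ A.onSample T, A.IsMaximizer T h) ∧
    ∀ erm, A.IsERM erm → ∀ T ≠ 0, erm T ∈ A.onSample T

/-- The split-sample growth rate of every ERM process at `m` is at most `B`. -/
def GrowthLE (A : AuctionClass n k) (m B : ℕ) : Prop :=
  ∀ erm, A.IsERM erm → splitSampleGrowth erm m ≤ B

/-- The sample complexity of every ERM process at accuracy `ε`, over all distributions with
revenues in `[0, 1]`, is at most `B`. -/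
def ComplexityLE (A : AuctionClass n k) (ε B : ℝ) : Prop :=
  ∀ erm, A.IsERM erm → (A.sampleComplexity erm A.unitRevenue ε : ℝ≥0∞) ≤ ENNReal.ofReal B

end AuctionClass

end

end SplitSample

namespace SplitSample

noncomputable section

/-! ### Revenue from a single good -/

/-! The proof rests on how the revenue from one good depends on the prices. For u > 0, revenue at
least u is reached exactly when some bidder's own price secures it: her price is accepted and is at
least u or, in a second-price auction, she is the top bidder, accepts, and her price or the best
competing bid is at least u (`le_goodRevenue_iff`). In this criterion the prices of different
bidders do not interact.

Consequently each price can be rounded up to the next sample value that it may take, without losing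
a sale or any revenue on the sample (`Presentation.exists_onSample_ge`). So some empirical maximizer
uses sample values, and the tie-breaking makes ERM do the same. Outputs on sub-samples of S then
have prices from S, and counting these bounds the growth rate.

For learning, `symmetrization` reduces the loss of ERM to signed sums over a double sample, where
coin flips decide which point of each pair is trained on. Massart's lemma with a count of the N
candidate auctions gives the loss √(2 log N / m), which serves for the guarantee with one bidder.
Inverting it would cost an additional log(nk) in the sample complexity. That is avoided by writing
revenue as the integral over u of the indicator of "revenue at least u". The level sets have VC
dimension at most 2n (`card_le_of_shatters`). Moreover, since the top bids are themselves admissible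
prices, unit revenue forces the top bids for all goods to sum to at most 1, so at level u only m/u
pairs of a sample point and a good matter. Massart's lemma with parameters tuned to u gives a bound
of order m δ u^(-3/4), which is integrable at 0 (`Presentation.rademacherLE`).

The factor 6 is a core-tail argument. Let r j be the best posted-price revenue from item j and R the
sum of the r j. A payment is at most what is extracted for the favorite item plus the values of the
other items. The first part is a one-good mechanism once the other values are fixed, and costs R in
total. Of the second part, values of at least R cost another R, because two such values rarely occur
together. Values below R have a sum with variance at most 2R², so by Chebyshev a bundle price
extracts them up to 2B + 2R, where B is the bundle revenue. Altogether this is 4R + 2B. -/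

open Classical in
/-- Revenue from one good at prices `q` and bids `b`. -/
def goodRevenue {n : ℕ} (rule : SaleRule) (q b : Fin n → ℝ≥0) : ℝ≥0 :=
  ∑ i, if rule.wins q b i then rule.charge q b i else 0

/-- Bidder `i` has the highest bid, ties going to the lowest index. -/
def IsTop {n : ℕ} (b : Fin n → ℝ≥0) (i : Fin n) : Prop :=
  ∀ i', b i' < b i ∨ (b i' = b i ∧ i ≤ i')

/-- The price `x` for bidder `i` secures a revenue of at least `u` at bids `b`. -/
def Secures {n : ℕ} (rule : SaleRule) (u x : ℝ≥0) (b : Fin n → ℝ≥0) (i : Fin n) : Prop :=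
  match rule with
  | .postedPrice => u ≤ x ∧ x ≤ b i
  | .secondPrice => IsTop b i ∧ x ≤ b i ∧ (u ≤ x ∨ u ≤ (Finset.univ.erase i).sup b)

variable {n : ℕ}

theorem wins_unique {rule : SaleRule} {q b : Fin n → ℝ≥0} {i j : Fin n}
    (hi : rule.wins q b i) (hj : rule.wins q b j) : i = j := by
  cases rule with
  | postedPrice =>
    rcases hi.2 j hj.1 with h | h <;> rcases hj.2 i hi.1 with h' | h'
    · exact absurd (h.trans h') (lt_irrefl _)
    · exact absurd (h'.1 ▸ h) (lt_irrefl _)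
    · exact absurd (h.1 ▸ h') (lt_irrefl _)
    · exact le_antisymm h.2 h'.2
  | secondPrice =>
    rcases hi.2 j with h | h <;> rcases hj.2 i with h' | h'
    · exact absurd (h.trans h') (lt_irrefl _)
    · exact absurd (h'.1 ▸ h) (lt_irrefl _)
    · exact absurd (h.1 ▸ h') (lt_irrefl _)
    · exact le_antisymm h.2 h'.2

theorem goodRevenue_of_wins {rule : SaleRule} {q b : Fin n → ℝ≥0} {i : Fin n}
    (hi : rule.wins q b i) : goodRevenue rule q b = rule.charge q b i := by
  classical
  unfold goodRevenue
  rw [Finset.sum_eq_single i]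
  · simp [hi]
  · intro j _ hj
    rw [if_neg]
    exact fun h => hj (wins_unique h hi)
  · simp

theorem exists_lex_max {p : Fin n → Prop} (f : Fin n → ℝ≥0) (hp : ∃ i, p i) :
    ∃ i, p i ∧ ∀ i', p i' → f i' < f i ∨ (f i' = f i ∧ i ≤ i') := by
  classical
  obtain ⟨i₀, hi₀⟩ := hp
  obtain ⟨a, ha, hmax⟩ := Finset.exists_max_image (Finset.univ.filter p) f ⟨i₀, by simpa⟩
  obtain ⟨i, hi, hmin⟩ := Finset.exists_min_image
    (Finset.univ.filter fun i => p i ∧ f i = f a) id ⟨a, by simpa using ha⟩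
  simp only [Finset.mem_filter, Finset.mem_univ, true_and, id] at ha hmax hi hmin
  refine ⟨i, hi.1, fun i' h' => ?_⟩
  rcases (hmax i' h').lt_or_eq with h | h
  · exact Or.inl (hi.2 ▸ h)
  · exact Or.inr ⟨h.trans hi.2.symm, hmin i' ⟨h', h⟩⟩

theorem exists_isTop (b : Fin n → ℝ≥0) (i : Fin n) : ∃ i, IsTop b i := by
  obtain ⟨i, -, hi⟩ := exists_lex_max (p := fun _ => True) b ⟨i, trivial⟩
  exact ⟨i, fun i' => hi i' trivial⟩

theorem IsTop.le {b : Fin n → ℝ≥0} {i : Fin n} (h : IsTop b i) (j : Fin n) : b j ≤ b i := by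
  rcases h j with h | h
  · exact h.le
  · exact h.1.le

/-- Posted prices sell at the highest accepted price, so any accepted price bounds the revenue from
below; in a second-price auction only the top bidder can win. Positivity of u excludes the case of
no sale. -/
theorem le_goodRevenue_iff {rule : SaleRule} {q b : Fin n → ℝ≥0} {u : ℝ≥0} (hu : 0 < u) :
    u ≤ goodRevenue rule q b ↔ ∃ i, Secures rule u (q i) b i := by
  classical
  constructor
  · intro h
    obtain ⟨i, hi⟩ : ∃ i, rule.wins q b i := by
      by_contra hno
      push Not at hno
      have : goodRevenue rule q b = 0 := by simp [goodRevenue, hno]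
      exact absurd (this ▸ h) (not_le.2 hu)
    rw [goodRevenue_of_wins hi] at h
    refine ⟨i, ?_⟩
    cases rule with
    | postedPrice => exact ⟨h, hi.1⟩
    | secondPrice => exact ⟨hi.2, hi.1, le_max_iff.1 h⟩
  · rintro ⟨i, hi⟩
    cases rule with
    | postedPrice =>
      obtain ⟨a, ha, hmax⟩ := exists_lex_max (p := fun i => q i ≤ b i) q ⟨i, hi.2⟩
      rw [goodRevenue_of_wins (rule := .postedPrice) (i := a) ⟨ha, hmax⟩]
      rcases hmax i hi.2 with h | h
      · exact hi.1.trans h.le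
      · exact hi.1.trans h.1.le
    | secondPrice =>
      rw [goodRevenue_of_wins (rule := .secondPrice) (i := i) ⟨hi.2.1, hi.1⟩]
      exact le_max_iff.2 hi.2.2

/-- A lower price is still accepted; the only harm it can do is to fall below u itself, which the
last hypothesis excludes. -/
theorem Secures.anti {rule : SaleRule} {u x y : ℝ≥0} {b : Fin n → ℝ≥0} {i : Fin n}
    (h : Secures rule u y b i) (hxy : x ≤ y) (hu : u ≤ y → u ≤ x) : Secures rule u x b i := by
  cases rule with
  | postedPrice => exact ⟨hu h.1, hxy.trans h.2⟩
  | secondPrice => exact ⟨h.1, hxy.trans h.2.1, h.2.2.imp_left hu⟩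

theorem Secures.price_le {rule : SaleRule} {u x : ℝ≥0} {b : Fin n → ℝ≥0} {i : Fin n}
    (h : Secures rule u x b i) : x ≤ b i := by
  cases rule with
  | postedPrice => exact h.2
  | secondPrice => exact h.2.1

theorem Secures.raise {rule : SaleRule} {u x y : ℝ≥0} {b : Fin n → ℝ≥0} {i : Fin n}
    (h : Secures rule u x b i) (hxy : x ≤ y) (hy : y ≤ b i) : Secures rule u y b i := by
  cases rule with
  | postedPrice => exact ⟨h.1.trans hxy, hy⟩
  | secondPrice => exact ⟨h.1, hy, h.2.2.imp_left hxy.trans'⟩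

theorem Secures.le_bid {rule : SaleRule} {u x : ℝ≥0} {b : Fin n → ℝ≥0} {i : Fin n}
    (h : Secures rule u x b i) : u ≤ b i := by
  cases rule with
  | postedPrice => exact h.1.trans h.2
  | secondPrice =>
    rcases h.2.2 with h' | h'
    · exact h'.trans h.2.1
    · exact h'.trans (Finset.sup_le fun j _ => h.1.le j)

theorem goodRevenue_le_of_forall {rule rule' : SaleRule} {q b q' b' : Fin n → ℝ≥0}
    (h : ∀ u, 0 < u → ∀ i, Secures rule u (q i) b i → ∃ i, Secures rule' u (q' i) b' i) :
    goodRevenue rule q b ≤ goodRevenue rule' q' b' := by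
  rcases eq_or_ne (goodRevenue rule q b) 0 with h0 | h0
  · exact h0 ▸ zero_le
  · have hpos := pos_iff_ne_zero.2 h0
    obtain ⟨i, hi⟩ := (le_goodRevenue_iff hpos).1 le_rfl
    exact (le_goodRevenue_iff hpos).2 (h _ hpos i hi)

/-- Raising prices without losing a buyer does not decrease the revenue. -/
theorem goodRevenue_mono_price {rule : SaleRule} {q q' b : Fin n → ℝ≥0}
    (h : ∀ i, q i ≤ b i → q i ≤ q' i ∧ q' i ≤ b i) :
    goodRevenue rule q b ≤ goodRevenue rule q' b :=
  goodRevenue_le_of_forall fun _ _ i hi =>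
    ⟨i, hi.raise (h i hi.price_le).1 (h i hi.price_le).2⟩

theorem goodRevenue_le_sup (rule : SaleRule) (q b : Fin n → ℝ≥0) :
    goodRevenue rule q b ≤ Finset.univ.sup b := by
  rcases eq_or_ne (goodRevenue rule q b) 0 with h0 | h0
  · exact h0 ▸ zero_le
  · obtain ⟨i, hi⟩ := (le_goodRevenue_iff (pos_iff_ne_zero.2 h0)).1 le_rfl
    exact hi.le_bid.trans (Finset.le_sup (f := b) (Finset.mem_univ i))

/-- A top bidder accepts this common price. Through this bound, unit revenue of a class becomes a
bound on the bids. -/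
theorem sup_le_goodRevenue (rule : SaleRule) (b : Fin n → ℝ≥0) :
    Finset.univ.sup b ≤ goodRevenue rule (fun _ => Finset.univ.sup b) b := by
  rcases eq_or_ne (Finset.univ.sup b) 0 with h0 | h0
  · exact h0 ▸ zero_le
  · rw [le_goodRevenue_iff (pos_iff_ne_zero.2 h0)]
    obtain ⟨i₀, -, -⟩ : ∃ i₀ ∈ Finset.univ, 0 < b i₀ :=
      Finset.lt_sup_iff.1 (pos_iff_ne_zero.2 h0)
    obtain ⟨i, hi⟩ := exists_isTop b i₀
    have hb : Finset.univ.sup b ≤ b i := Finset.sup_le fun j _ => hi.le j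
    refine ⟨i, ?_⟩
    cases rule with
    | postedPrice => exact ⟨le_rfl, hb⟩
    | secondPrice => exact ⟨hi, hb, Or.inl le_rfl⟩

theorem goodRevenue_eq_zero {rule : SaleRule} {q b : Fin n → ℝ≥0} (h : ∀ i, b i < q i) :
    goodRevenue rule q b = 0 := by
  by_contra h0
  obtain ⟨i, hi⟩ := (le_goodRevenue_iff (pos_iff_ne_zero.2 h0)).1 le_rfl
  exact (h i).not_ge hi.price_le

theorem measurable_goodRevenue (rule : SaleRule) :
    Measurable fun p : (Fin n → ℝ≥0) × (Fin n → ℝ≥0) => goodRevenue rule p.1 p.2 := by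
  classical
  have hq : ∀ i : Fin n, Measurable fun p : (Fin n → ℝ≥0) × (Fin n → ℝ≥0) => p.1 i :=
    fun i => (measurable_pi_apply i).comp measurable_fst
  have hb : ∀ i : Fin n, Measurable fun p : (Fin n → ℝ≥0) × (Fin n → ℝ≥0) => p.2 i :=
    fun i => (measurable_pi_apply i).comp measurable_snd
  refine Finset.measurable_sum _ fun i _ => Measurable.ite ?_ ?_ measurable_const
  · have hall : ∀ P : Fin n → (Fin n → ℝ≥0) × (Fin n → ℝ≥0) → Prop,
        (∀ i', MeasurableSet {p | P i' p}) → MeasurableSet {p | ∀ i', P i' p} := by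
      intro P hP
      rw [Set.ofPred_forall]
      exact MeasurableSet.iInter hP
    cases rule with
    | postedPrice =>
      exact (measurableSet_le (hq i) (hb i)).inter (hall _ fun i' =>
        (measurableSet_le (hq i') (hb i')).imp
          ((measurableSet_lt (hq i') (hq i)).union
            ((measurableSet_eq_fun (hq i') (hq i)).inter (MeasurableSet.const _))))
    | secondPrice =>
      exact (measurableSet_le (hq i) (hb i)).inter (hall _ fun i' =>
        (measurableSet_lt (hb i') (hb i)).union
          ((measurableSet_eq_fun (hb i') (hb i)).inter (MeasurableSet.const _)))
  · cases rule with
    | postedPrice => exact hq i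
    | secondPrice =>
      refine (hq i).max ?_
      generalize Finset.univ.erase i = s
      induction s using Finset.induction_on with
      | empty => simp
      | insert j s _ ih => simpa only [Finset.sup_insert] using (hb j).max ih

/-- With a single bidder both rules post a price. -/
theorem goodRevenue_one (rule : SaleRule) (q b : Fin 1 → ℝ≥0) :
    goodRevenue rule q b = if q 0 ≤ b 0 then q 0 else 0 := by
  split_ifs with h
  · cases rule with
    | postedPrice =>
      rw [goodRevenue_of_wins (rule := .postedPrice) (i := 0)
        ⟨h, fun i' _ => by simp [Subsingleton.elim i' 0]⟩]
      rfl
    | secondPrice =>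
      rw [goodRevenue_of_wins (rule := .secondPrice) (i := 0)
        ⟨h, fun i' => by simp [Subsingleton.elim i' 0]⟩]
      simp [SaleRule.charge]
  · exact goodRevenue_eq_zero fun i => by simpa [Subsingleton.elim i 0] using h

end

noncomputable section

/-! ### Pricing classes as separate sales of several goods -/

/-- A description of a class of auctions as the separate sale of `K` goods: hypotheses are price
vectors with coordinates in `I`, `slot i j` is the coordinate that holds the price of good `j` for
bidder `i`, and `bid j v i` is the value of bidder `i` for good `j`. -/
structure Presentation {n k : ℕ} (rule : SaleRule) (A : AuctionClass n k) where
  K : ℕ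
  I : Type
  fintypeI : Fintype I
  slot : Fin n → Fin K → I
  good : I → Fin K
  bid : Fin K → Profile n k → Fin n → ℝ≥0
  price : A.Hyp ≃ (I → ℝ≥0)
  good_slot : ∀ i j, good (slot i j) = j
  exists_slot : ∀ a, ∃ i, slot i (good a) = a
  measurable_bid : ∀ j, Measurable (bid j)
  revenue_eq : ∀ h v, (A.mech h).revenue v =
    ∑ j, (goodRevenue rule (fun i => price h (slot i j)) (bid j v) : ℝ)
  mem_onSample : ∀ h T, h ∈ A.onSample T ↔
    ∀ a, ∃ v ∈ T, ∃ i, slot i (good a) = a ∧ price h a = bid (good a) v i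

variable {n k : ℕ} {rule : SaleRule}

theorem bundleMechanism_revenue (rule : SaleRule) (q : Fin n → ℝ≥0) (v : Profile n k) :
    (bundleMechanism rule q).revenue v = (goodRevenue rule q fun i => ∑ j, v i j : ℝ≥0) := by
  simp only [Mechanism.revenue, bundleMechanism, goodRevenue, NNReal.coe_sum, apply_ite NNReal.toReal,
    NNReal.coe_zero]

theorem itemMechanism_revenue (rule : SaleRule) (q : Fin n → Fin k → ℝ≥0) (v : Profile n k) :
    (itemMechanism rule q).revenue v =
      ∑ j, (goodRevenue rule (fun i => q i j) (fun i => v i j) : ℝ) := by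
  simp only [Mechanism.revenue, itemMechanism, goodRevenue, NNReal.coe_sum, apply_ite NNReal.toReal,
    NNReal.coe_zero]
  rw [Finset.sum_comm]

theorem measurable_bundleBid : Measurable fun (v : Profile n k) (i : Fin n) => ∑ j, v i j := by
  fun_prop

theorem measurable_itemBid (j : Fin k) : Measurable fun (v : Profile n k) (i : Fin n) => v i j := by
  fun_prop

def anonymousBundlePresentation (hn : 0 < n) :
    Presentation rule (anonymousBundlePricing rule n k) where
  K := 1
  I := Unit
  fintypeI := inferInstance
  slot _ _ := ()
  good _ := 0
  bid _ v i := ∑ j, v i j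
  price := (Equiv.funUnique Unit ℝ≥0).symm
  good_slot _ _ := Subsingleton.elim _ _
  exists_slot _ := ⟨⟨0, hn⟩, rfl⟩
  measurable_bid _ := measurable_bundleBid
  revenue_eq h v := by
    refine (bundleMechanism_revenue rule (fun _ => h) v).trans ?_
    rw [Fin.sum_univ_one]
    rfl
  mem_onSample _ _ := ⟨fun ⟨v, hv, i, hi⟩ _ => ⟨v, hv, i, rfl, hi⟩,
    fun H => let ⟨v, hv, i, _, hi⟩ := H (); ⟨v, hv, i, hi⟩⟩

def bundlePresentation : Presentation rule (bundlePricing rule n k) where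
  K := 1
  I := Fin n
  fintypeI := inferInstance
  slot i _ := i
  good _ := 0
  bid _ v i := ∑ j, v i j
  price := Equiv.refl _
  good_slot _ _ := Subsingleton.elim _ _
  exists_slot a := ⟨a, rfl⟩
  measurable_bid _ := measurable_bundleBid
  revenue_eq h v := by
    refine (bundleMechanism_revenue rule h v).trans ?_
    rw [Fin.sum_univ_one]
    rfl
  mem_onSample _ _ := ⟨fun H i => let ⟨v, hv, hi⟩ := H i; ⟨v, hv, i, rfl, hi⟩,
    fun H i => let ⟨v, hv, _, hj, hi⟩ := H i; ⟨v, hv, hj ▸ hi⟩⟩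

def anonymousItemPresentation (hn : 0 < n) :
    Presentation rule (anonymousItemPricing rule n k) where
  K := k
  I := Fin k
  fintypeI := inferInstance
  slot _ j := j
  good j := j
  bid j v i := v i j
  price := Equiv.refl _
  good_slot _ _ := rfl
  exists_slot _ := ⟨⟨0, hn⟩, rfl⟩
  measurable_bid := measurable_itemBid
  revenue_eq h v := itemMechanism_revenue rule (fun _ => h) v
  mem_onSample _ _ := ⟨fun H j => let ⟨v, hv, i, hi⟩ := H j; ⟨v, hv, i, rfl, hi⟩,
    fun H j => let ⟨v, hv, i, _, hi⟩ := H j; ⟨v, hv, i, hi⟩⟩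

def itemPresentation : Presentation rule (itemPricing rule n k) where
  K := k
  I := Fin n × Fin k
  fintypeI := inferInstance
  slot i j := (i, j)
  good a := a.2
  bid j v i := v i j
  price := (Equiv.curry (Fin n) (Fin k) ℝ≥0).symm
  good_slot _ _ := rfl
  exists_slot a := ⟨a.1, rfl⟩
  measurable_bid := measurable_itemBid
  revenue_eq h v := itemMechanism_revenue rule h v
  mem_onSample _ _ := ⟨fun H a => let ⟨v, hv, hi⟩ := H a.1 a.2; ⟨v, hv, a.1, rfl, hi⟩,
    fun H i j => let ⟨v, hv, _, ha, hi⟩ := H (i, j); ⟨v, hv, (show _ = i from congrArg Prod.fst ha) ▸ hi⟩⟩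

/-! ### Rounding prices to sample values -/

/-- Take the least element of C above x. If there is none, any element will do: no candidate buyer
accepts x, and there is no sale to preserve. -/
theorem exists_round (C : Finset ℝ≥0) (hC : C.Nonempty) (x : ℝ≥0) :
    ∃ y ∈ C, ∀ c ∈ C, x ≤ c → x ≤ y ∧ y ≤ c := by
  by_cases h : (C.filter (x ≤ ·)).Nonempty
  · obtain ⟨y, hy, hmin⟩ := Finset.exists_min_image _ id h
    simp only [Finset.mem_filter, id, and_imp] at hy hmin
    exact ⟨y, hy.1, fun c hc hxc => ⟨hy.2, hmin c hc hxc⟩⟩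
  · obtain ⟨y, hy⟩ := hC
    refine ⟨y, hy, fun c hc hxc => absurd ⟨c, ?_⟩ h⟩
    simp [hc, hxc]

namespace Presentation

variable {A : AuctionClass n k} (P : Presentation rule A)

open Classical in
/-- The sample values that may serve as the price in coordinate `a`. -/
def candidates (T : Multiset (Profile n k)) (a : P.I) : Finset ℝ≥0 :=
  (T.toFinset ×ˢ Finset.univ.filter fun i => P.slot i (P.good a) = a).image
    fun p => P.bid (P.good a) p.1 p.2

theorem mem_candidates {T : Multiset (Profile n k)} {a : P.I} {x : ℝ≥0} :
    x ∈ P.candidates T a ↔ ∃ v ∈ T, ∃ i, P.slot i (P.good a) = a ∧ x = P.bid (P.good a) v i := by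
  classical
  simp only [candidates, Finset.mem_image, Finset.mem_product, Multiset.mem_toFinset,
    Finset.mem_filter, Finset.mem_univ, true_and, Prod.exists]
  constructor
  · rintro ⟨v, i, ⟨hv, hi⟩, rfl⟩
    exact ⟨v, hv, i, hi, rfl⟩
  · rintro ⟨v, hv, i, hi, rfl⟩
    exact ⟨v, i, ⟨hv, hi⟩, rfl⟩

theorem mem_onSample_iff {T : Multiset (Profile n k)} {h : A.Hyp} :
    h ∈ A.onSample T ↔ ∀ a, P.price h a ∈ P.candidates T a := by
  simp only [P.mem_onSample, mem_candidates]

theorem candidates_nonempty {T : Multiset (Profile n k)} (hT : T ≠ 0) (a : P.I) :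
    (P.candidates T a).Nonempty := by
  obtain ⟨v, hv⟩ := Multiset.exists_mem_of_ne_zero hT
  obtain ⟨i, hi⟩ := P.exists_slot a
  exact ⟨_, P.mem_candidates.2 ⟨v, hv, i, hi, rfl⟩⟩

open Classical in
theorem card_candidates_le (T : Multiset (Profile n k)) (a : P.I) :
    (P.candidates T a).card ≤
      T.card * (Finset.univ.filter fun i => P.slot i (P.good a) = a).card := by
  refine Finset.card_image_le.trans ?_
  rw [Finset.card_product]
  exact Nat.mul_le_mul_right _ (Multiset.toFinset_card_le T)

-- The prices range over a product of candidate sets. The number c bounds how many bidders share a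
-- slot: n for anonymous prices, 1 for individual ones.
open Classical in
theorem encard_onSample_le (T : Multiset (Profile n k)) (c : ℕ)
    (hc : ∀ a, (Finset.univ.filter fun i => P.slot i (P.good a) = a).card ≤ c) :
    (A.onSample T).encard ≤ ((T.card * c) ^ Nat.card P.I : ℕ) := by
  let _ := P.fintypeI
  have hsub : P.price '' A.onSample T ⊆ (Fintype.piFinset (P.candidates T) : Set (P.I → ℝ≥0)) := by
    rintro _ ⟨h, hh, rfl⟩
    simpa using P.mem_onSample_iff.1 hh
  rw [← P.price.injective.encard_image]
  refine (Set.encard_le_encard hsub).trans ?_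
  rw [Set.encard_coe_eq_coe_finsetCard, Fintype.card_piFinset, Nat.card_eq_fintype_card,
    ← Finset.card_univ]
  exact_mod_cast Finset.prod_le_pow_card _ _ _ fun a _ =>
    (P.card_candidates_le T a).trans (Nat.mul_le_mul_left _ (hc a))

/-- Round each price up to the next candidate. A sampled bid that meets the old price is itself a
candidate for that slot, hence meets the new one, and revenue does not drop on any sample point. -/
theorem exists_onSample_ge (P : Presentation rule A) {T : Multiset (Profile n k)} (hT : T ≠ 0) (h : A.Hyp) :
    ∃ h' ∈ A.onSample T, ∀ v ∈ T, (A.mech h).revenue v ≤ (A.mech h').revenue v := by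
  choose y hy hround using fun a =>
    exists_round (P.candidates T a) (P.candidates_nonempty hT a) (P.price h a)
  refine ⟨P.price.symm y, P.mem_onSample_iff.2 fun a => by simpa using hy a, fun v hv => ?_⟩
  rw [P.revenue_eq, P.revenue_eq]
  refine Finset.sum_le_sum fun j _ => NNReal.coe_le_coe.2 (goodRevenue_mono_price fun i hi => ?_)
  rw [Equiv.apply_symm_apply]
  refine hround (P.slot i j) _ (P.mem_candidates.2 ⟨v, hv, i, ?_, ?_⟩) hi
  · rw [P.good_slot]
  · rw [P.good_slot]

end Presentation

/-! ### Well-behaved classes -/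

/-- The properties of a class of auctions on which learning by empirical revenue maximization
rests: some empirical maximizer uses sample values, and the hypotheses with sample values are
finitely many measurable functions of the sample. -/
structure AuctionClass.IsTame (A : AuctionClass n k) : Prop where
  exists_isMaximizer : ∀ T ≠ 0, ∃ h ∈ A.onSample T, A.IsMaximizer T h
  onSample_mono : ∀ {T S : Multiset (Profile n k)}, T ⊆ S → A.onSample T ⊆ A.onSample S
  indexed : ∀ m, ∃ (Φ : Type) (_ : Fintype Φ) (hyp : Φ → (Fin m → Profile n k) → A.Hyp),
    (∀ s, A.onSample (Finset.univ.val.map s) = Set.range fun φ => hyp φ s) ∧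
    ∀ φ, Measurable fun p : (Fin m → Profile n k) × Profile n k =>
      (A.mech (hyp φ p.1)).revenue p.2
  measurable_revenue : ∀ h, Measurable (A.mech h).revenue

theorem Presentation.isTame {A : AuctionClass n k} (P : Presentation rule A) : A.IsTame where
  exists_isMaximizer T hT := by
    classical
    have hfin : (A.onSample T).Finite :=
      Set.finite_of_encard_le_coe (P.encard_onSample_le T n fun a =>
        (Finset.card_filter_le _ _).trans_eq (by simp))
    -- Rounding an arbitrary hypothesis, here the zero prices, shows that the finite set to maximize
    -- over is nonempty.
    obtain ⟨h₀, hh₀, -⟩ := P.exists_onSample_ge hT (P.price.symm 0)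
    obtain ⟨h, hh, hmax⟩ := hfin.exists_maximalFor (A.empRevenue T) _ ⟨h₀, hh₀⟩
    refine ⟨h, hh, fun g => ?_⟩
    obtain ⟨g', hg', hle⟩ := P.exists_onSample_ge hT g
    have h1 : A.empRevenue T g ≤ A.empRevenue T g' :=
      div_le_div_of_nonneg_right (Multiset.sum_map_le_sum_map _ _ hle) (Nat.cast_nonneg _)
    exact h1.trans ((le_total _ _).elim id (hmax hg'))
  onSample_mono {T S} hTS h hh := by
    rw [P.mem_onSample] at hh ⊢
    intro a
    obtain ⟨v, hv, hi⟩ := hh a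
    exact ⟨v, hTS hv, hi⟩
  indexed m := by
    classical
    let _ := P.fintypeI
    refine ⟨∀ a : P.I, Fin m × {i : Fin n // P.slot i (P.good a) = a}, inferInstance,
      fun φ s => P.price.symm fun a => P.bid (P.good a) (s (φ a).1) (φ a).2, fun s => ?_,
      fun φ => ?_⟩
    · ext h
      rw [P.mem_onSample]
      simp only [Multiset.mem_map, Finset.mem_val, Finset.mem_univ, true_and, Set.mem_range,
        exists_exists_eq_and]
      constructor
      · intro H
        choose t i hi hp using H
        refine ⟨fun a => (t a, ⟨i a, hi a⟩), ?_⟩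
        rw [Equiv.symm_apply_eq]
        exact funext fun a => (hp a).symm
      · rintro ⟨φ, rfl⟩ a
        exact ⟨(φ a).1, (φ a).2, (φ a).2.2, by rw [Equiv.apply_symm_apply]⟩
    · simp only [P.revenue_eq, Equiv.apply_symm_apply]
      refine Finset.measurable_sum _ fun j _ => measurable_coe_nnreal_real.comp
        ((measurable_goodRevenue rule).comp (Measurable.prodMk ?_ ?_))
      · refine measurable_pi_lambda _ fun i => ?_
        exact (measurable_pi_apply _).comp ((P.measurable_bid _).comp
          ((measurable_pi_apply _).comp measurable_fst))
      · exact (P.measurable_bid j).comp measurable_snd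
  measurable_revenue h := by
    have : (A.mech h).revenue = fun v => _ := funext (P.revenue_eq h)
    rw [this]
    exact Finset.measurable_sum _ fun j _ => measurable_coe_nnreal_real.comp
      ((measurable_goodRevenue rule).comp (measurable_const.prodMk (P.measurable_bid j)))

theorem AuctionClass.IsTame.bestOf {A B : AuctionClass n k} (hA : A.IsTame) (hB : B.IsTame) :
    (bestOf A B).IsTame where
  exists_isMaximizer T hT := by
    obtain ⟨a, ha, hamax⟩ := hA.exists_isMaximizer T hT
    obtain ⟨b, hb, hbmax⟩ := hB.exists_isMaximizer T hT
    rcases le_total (A.empRevenue T a) (B.empRevenue T b) with hab | hab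
    · refine ⟨Sum.inr b, Or.inr ⟨b, hb, rfl⟩, ?_⟩
      rintro (h | h)
      · exact (hamax h).trans hab
      · exact hbmax h
    · refine ⟨Sum.inl a, Or.inl ⟨a, ha, rfl⟩, ?_⟩
      rintro (h | h)
      · exact hamax h
      · exact (hbmax h).trans hab
  onSample_mono hTS := Set.union_subset_union (Set.image_mono (hA.onSample_mono hTS))
    (Set.image_mono (hB.onSample_mono hTS))
  indexed m := by
    obtain ⟨Φ, _, f, hf, hfm⟩ := hA.indexed m
    obtain ⟨Ψ, _, g, hg, hgm⟩ := hB.indexed m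
    refine ⟨Φ ⊕ Ψ, inferInstance,
      fun x s => x.elim (fun φ => Sum.inl (f φ s)) (fun ψ => Sum.inr (g ψ s)), fun s => ?_, ?_⟩
    · change Sum.inl '' A.onSample _ ∪ Sum.inr '' B.onSample _ = _
      rw [hf, hg, Sum.range_eq, ← Set.range_comp, ← Set.range_comp]
      rfl
    · rintro (φ | ψ)
      · exact hfm φ
      · exact hgm ψ
  measurable_revenue := by
    rintro (h | h)
    · exact hA.measurable_revenue h
    · exact hB.measurable_revenue h

theorem AuctionClass.IsTame.ermOnSample {A : AuctionClass n k} (hA : A.IsTame) : A.ERMOnSample :=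
  ⟨hA.exists_isMaximizer, fun _ herm T hT => herm.favors_sample T hT (hA.exists_isMaximizer T hT)⟩

/-! ### Split-sample growth -/

/-- Sample values of a sub-sample are sample values of S, so all outputs lie in `A.onSample S`. -/
theorem AuctionClass.IsTame.growthLE {A : AuctionClass n k} (hA : A.IsTame) {m B : ℕ} (hm : 0 < m)
    (hB : ∀ S : Multiset (Profile n k), S.card = m → (A.onSample S).encard ≤ B) :
    A.GrowthLE m B := by
  intro erm herm
  refine iSup₂_le fun S hS => (Set.encard_le_encard ?_).trans (hB S hS)
  rintro h ⟨T, hTS, hT, rfl⟩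
  have hT0 : T ≠ 0 := by
    rintro rfl
    simp only [Multiset.card_zero] at hT
    omega
  exact hA.onSample_mono (Multiset.subset_of_le hTS) (hA.ermOnSample.2 erm herm T hT0)

/-- Since ⌈1/2⌉ = 1, the only sub-sample is S itself. This covers the case in which counting the
union of two classes would give 2 instead of 1. -/
theorem growthLE_one (A : AuctionClass n k) : A.GrowthLE 1 1 := by
  intro erm _
  refine iSup₂_le fun S hS => ?_
  have : splitSampleSpace erm S ⊆ {erm S} := by
    rintro h ⟨T, hTS, hT, rfl⟩
    rw [Multiset.eq_of_le_of_card_le hTS (by omega)]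
    rfl
  simpa using Set.encard_le_encard this

theorem encard_onSample_anonymousBundle (hn : 0 < n) (S : Multiset (Profile n k)) :
    ((anonymousBundlePricing rule n k).onSample S).encard ≤ (S.card * n : ℕ) := by
  classical
  refine ((anonymousBundlePresentation hn).encard_onSample_le S n fun a =>
    (Finset.card_filter_le _ _).trans_eq (by simp)).trans_eq ?_
  change (((S.card * n) ^ Nat.card Unit : ℕ) : ℕ∞) = _
  simp

theorem encard_onSample_bundle (S : Multiset (Profile n k)) :
    ((bundlePricing rule n k).onSample S).encard ≤ (S.card ^ n : ℕ) := by
  classical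
  refine (bundlePresentation.encard_onSample_le S 1 fun a => Finset.card_le_one.2 ?_).trans_eq ?_
  · simp only [Finset.mem_filter, Finset.mem_univ, true_and]
    exact fun i hi j hj => hi.trans hj.symm
  · change (((S.card * 1) ^ Nat.card (Fin n) : ℕ) : ℕ∞) = _
    simp

theorem encard_onSample_anonymousItem (hn : 0 < n) (S : Multiset (Profile n k)) :
    ((anonymousItemPricing rule n k).onSample S).encard ≤ ((n * S.card) ^ k : ℕ) := by
  classical
  refine ((anonymousItemPresentation hn).encard_onSample_le S n fun a =>
    (Finset.card_filter_le _ _).trans_eq (by simp)).trans_eq ?_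
  change (((S.card * n) ^ Nat.card (Fin k) : ℕ) : ℕ∞) = _
  simp [mul_comm]

theorem encard_onSample_item (S : Multiset (Profile n k)) :
    ((itemPricing rule n k).onSample S).encard ≤ (S.card ^ (n * k) : ℕ) := by
  classical
  refine (itemPresentation.encard_onSample_le S 1 fun a => Finset.card_le_one.2 ?_).trans_eq ?_
  · simp only [Finset.mem_filter, Finset.mem_univ, true_and]
    exact fun i hi j hj => congrArg Prod.fst (hi.trans hj.symm)
  · change (((S.card * 1) ^ Nat.card (Fin n × Fin k) : ℕ) : ℕ∞) = _
    simp

/-- The sum x + x ^ k' is at most 2 x ^ k', and the factor 2 is absorbed by one more factor x. -/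
theorem encard_onSample_bestOf_le {A B : AuctionClass n k} {S : Multiset (Profile n k)} {x k' : ℕ}
    (hx : 2 ≤ x) (hk : 0 < k') (hA : (A.onSample S).encard ≤ x)
    (hB : (B.onSample S).encard ≤ (x ^ k' : ℕ)) :
    ((bestOf A B).onSample S).encard ≤ (x ^ (k' + 1) : ℕ) := by
  have h1 : ((bestOf A B).onSample S).encard ≤ (x : ℕ∞) + (x ^ k' : ℕ) := by
    refine (Set.encard_union_le _ _).trans (add_le_add ?_ ?_)
    · exact (Sum.inl_injective.encard_image _).trans_le hA
    · exact (Sum.inr_injective.encard_image _).trans_le hB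
  refine h1.trans ?_
  have h2 : x + x ^ k' ≤ x ^ (k' + 1) := by
    have : x ≤ x ^ k' := Nat.le_self_pow hk.ne' x
    calc x + x ^ k' ≤ 2 * x ^ k' := by omega
      _ ≤ x * x ^ k' := Nat.mul_le_mul_right _ hx
      _ = x ^ (k' + 1) := by ring
  exact_mod_cast h2

theorem encard_onSample_anonymousBest (hn : 0 < n) (hk : 0 < k) {S : Multiset (Profile n k)}
    (hS : 2 ≤ S.card * n) :
    ((anonymousBestPricing rule n k).onSample S).encard ≤ ((S.card * n) ^ (k + 1) : ℕ) :=
  encard_onSample_bestOf_le hS hk (encard_onSample_anonymousBundle hn S)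
    (by simpa only [mul_comm] using encard_onSample_anonymousItem hn S)

theorem encard_onSample_best (hn : 0 < n) (hk : 0 < k) {S : Multiset (Profile n k)}
    (hS : 2 ≤ S.card) :
    ((bestPricing rule n k).onSample S).encard ≤ (S.card ^ (n * (k + 1)) : ℕ) := by
  -- The base for the union bound is x = |S| ^ n, the number of bundle price vectors.
  rw [pow_mul]
  refine encard_onSample_bestOf_le (hS.trans (Nat.le_self_pow hn.ne' _)) hk
    (encard_onSample_bundle S) ?_
  rw [← pow_mul]
  exact encard_onSample_item S

theorem isTame_anonymousBundle (hn : 0 < n) : (anonymousBundlePricing rule n k).IsTame :=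
  (anonymousBundlePresentation hn).isTame

theorem isTame_bundle : (bundlePricing rule n k).IsTame := bundlePresentation.isTame

theorem isTame_anonymousItem (hn : 0 < n) : (anonymousItemPricing rule n k).IsTame :=
  (anonymousItemPresentation hn).isTame

theorem isTame_item : (itemPricing rule n k).IsTame := itemPresentation.isTame

theorem isTame_anonymousBest (hn : 0 < n) : (anonymousBestPricing rule n k).IsTame :=
  (isTame_anonymousBundle hn).bestOf (isTame_anonymousItem hn)

theorem isTame_best : (bestPricing rule n k).IsTame := isTame_bundle.bestOf isTame_item

theorem growthLE_anonymousBest (hn : 0 < n) (hk : 0 < k) {m : ℕ} (hm : 0 < m) :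
    (anonymousBestPricing rule n k).GrowthLE m ((m * n) ^ (k + 1)) := by
  by_cases h : 2 ≤ m * n
  · refine (isTame_anonymousBest hn).growthLE hm fun S hS => ?_
    subst hS
    exact encard_onSample_anonymousBest hn hk h
  · have h1 : m * n = 1 := by
      have := Nat.mul_pos hm hn
      omega
    rw [h1, one_pow, Nat.eq_one_of_mul_eq_one_right h1]
    exact growthLE_one _

theorem growthLE_best (hn : 0 < n) (hk : 0 < k) {m : ℕ} (hm : 0 < m) :
    (bestPricing rule n k).GrowthLE m (m ^ (n * (k + 1))) := by
  by_cases h : 2 ≤ m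
  · refine isTame_best.growthLE hm fun S hS => ?_
    subst hS
    exact encard_onSample_best hn hk h
  · obtain rfl : m = 1 := by omega
    rw [one_pow]
    exact growthLE_one _

end

noncomputable section

/-! ### Symmetrization -/

/-- The sign of a coin flip. -/
def coinSign (b : Bool) : ℝ := if b then 1 else -1

/-- The sub-sample of a double sample that is picked by coin flips. -/
def pick {m : ℕ} {Z : Type*} (σ : Fin m → Bool) (s s' : Fin m → Z) : Fin m → Z :=
  fun t => if σ t then s t else s' t

section

variable {Z : Type*} [MeasurableSpace Z] {m : ℕ}

/-- Exchange the two halves of a double sample where the coin shows tails. -/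
def flipPairs (σ : Fin m → Bool) (ω : Fin m → Z × Z) : Fin m → Z × Z :=
  fun t => if σ t then ω t else (ω t).swap

theorem measurePreserving_flipPairs (D : Measure Z) [IsProbabilityMeasure D] (σ : Fin m → Bool) :
    MeasurePreserving (flipPairs (Z := Z) σ) (Measure.pi fun _ => D.prod D)
      (Measure.pi fun _ => D.prod D) := by
  refine measurePreserving_pi (fun _ : Fin m => D.prod D) (fun _ : Fin m => D.prod D)
    (f := fun t p => if σ t then p else p.swap) fun t => ?_
  cases σ t
  · simpa using Measure.measurePreserving_swap (μ := D) (ν := D)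
  · exact MeasurePreserving.id (D.prod D)

theorem measurePreserving_sample_fresh (D : Measure Z) [IsProbabilityMeasure D] (t : Fin m) :
    MeasurePreserving (fun ω : Fin m → Z × Z => ((fun i => (ω i).1), (ω t).2))
      (Measure.pi fun _ => D.prod D) ((Measure.pi fun _ => D).prod D) :=
  ((MeasurePreserving.id _).prod (measurePreserving_eval (fun _ : Fin m => D) t)).comp
    (measurePreserving_arrowProdEquivProdArrow Z Z (Fin m) (fun _ => D) (fun _ => D))

theorem measurePreserving_sample (D : Measure Z) [IsProbabilityMeasure D] :
    MeasurePreserving (fun (ω : Fin m → Z × Z) i => (ω i).1)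
      (Measure.pi fun _ => D.prod D) (Measure.pi fun _ => D) :=
  measurePreserving_fst.comp
    (measurePreserving_arrowProdEquivProdArrow Z Z (Fin m) (fun _ => D) (fun _ => D))

theorem integrable_of_mem_unit {X : Type*} [MeasurableSpace X] {μ : Measure X}
    [IsFiniteMeasure μ] {f : X → ℝ} (hf : Measurable f) (h : ∀ x, f x ∈ Set.Icc (0 : ℝ) 1) :
    Integrable f μ :=
  Integrable.of_mem_Icc 0 1 hf.aemeasurable (Filter.Eventually.of_forall h)

/-- If the deviation between the two halves of every good double sample is small on average over
all coin flips, then so is the expected deviation between sample average and true average. -/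
theorem symmetrization {D : Measure Z} [IsProbabilityMeasure D] {f : (Fin m → Z) → Z → ℝ}
    (hf : Measurable fun p : (Fin m → Z) × Z => f p.1 p.2)
    (hf01 : ∀ s v, f s v ∈ Set.Icc (0 : ℝ) 1) {good : Z → Prop} (hgood : ∀ᵐ v ∂D, good v) {β : ℝ}
    (hβ : ∀ s s' : Fin m → Z, (∀ t, good (s t)) → (∀ t, good (s' t)) →
      ∑ σ : Fin m → Bool, ∑ t, coinSign (σ t) *
        (f (pick σ s s') (s t) - f (pick σ s s') (s' t)) ≤ 2 ^ m * (m * β)) :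
    ∫ s, ∑ t, f s (s t) ∂(Measure.pi fun _ => D) ≤
      m * ∫ s, ∫ v, f s v ∂D ∂(Measure.pi fun _ => D) + m * β := by
  set Q : Measure (Fin m → Z × Z) := Measure.pi fun _ => D.prod D with hQ
  have hmeas1 : ∀ t, Measurable fun s : Fin m → Z => f s (s t) := fun t =>
    hf.comp (measurable_id.prodMk (measurable_pi_apply t))
  have hfst : Measurable fun (ω : Fin m → Z × Z) i => (ω i).1 := by fun_prop
  have hA : ∀ t, Measurable fun ω : Fin m → Z × Z => f (fun i => (ω i).1) (ω t).1 := fun t =>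
    (hmeas1 t).comp hfst
  have hB : ∀ t, Measurable fun ω : Fin m → Z × Z => f (fun i => (ω i).1) (ω t).2 := fun t =>
    hf.comp (hfst.prodMk (measurable_snd.comp (measurable_pi_apply t)))
  -- The first halves are the training sample, the second halves a fresh one. `F` is the gap between
  -- the two revenue sums of the hypothesis trained on the first halves.
  set F : (Fin m → Z × Z) → ℝ := fun ω =>
    ∑ t, (f (fun i => (ω i).1) (ω t).1 - f (fun i => (ω i).1) (ω t).2) with hF
  have hAi : ∀ t, Integrable (fun ω : Fin m → Z × Z => f (fun i => (ω i).1) (ω t).1) Q := fun t =>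
    integrable_of_mem_unit (hA t) fun ω => hf01 _ _
  have hBi : ∀ t, Integrable (fun ω : Fin m → Z × Z => f (fun i => (ω i).1) (ω t).2) Q := fun t =>
    integrable_of_mem_unit (hB t) fun ω => hf01 _ _
  have hFi : Integrable F Q := integrable_finsetSum _ fun t _ => (hAi t).sub (hBi t)
  have hF_eq : ∫ ω, F ω ∂Q = ∫ s, ∑ t, f s (s t) ∂(Measure.pi fun _ => D) -
      m * ∫ s, ∫ v, f s v ∂D ∂(Measure.pi fun _ => D) := by
    have h1 : ∀ t, ∫ ω, f (fun i => (ω i).1) (ω t).1 ∂Q =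
        ∫ s, f s (s t) ∂(Measure.pi fun _ => D) := fun t => by
      rw [← (measurePreserving_sample (m := m) D).map_eq,
        integral_map hfst.aemeasurable (hmeas1 t).aestronglyMeasurable]
    have h2 : ∀ t, ∫ ω, f (fun i => (ω i).1) (ω t).2 ∂Q =
        ∫ s, ∫ v, f s v ∂D ∂(Measure.pi fun _ => D) := fun t => by
      have h3 := integral_prod (μ := Measure.pi fun _ : Fin m => D) (ν := D)
        (fun p => f p.1 p.2) (integrable_of_mem_unit hf fun _ => hf01 _ _)
      rw [← h3, ← (measurePreserving_sample_fresh (m := m) D t).map_eq,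
        integral_map (measurePreserving_sample_fresh (m := m) D t).measurable.aemeasurable
          hf.aestronglyMeasurable]
    have h3 : ∫ ω, F ω ∂Q = ∑ t, ∫ ω, (f (fun i => (ω i).1) (ω t).1 -
        f (fun i => (ω i).1) (ω t).2) ∂Q :=
      integral_finsetSum _ fun t _ => (hAi t).sub (hBi t)
    rw [h3]
    simp_rw [integral_sub (hAi _) (hBi _), h1, h2]
    rw [Finset.sum_sub_distrib, integral_finsetSum _ fun t _ =>
      integrable_of_mem_unit (hmeas1 t) fun _ => hf01 _ _]
    simp
  -- Swapping within pairs preserves the law, so the expected gap equals its average over all 2 ^ m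
  -- flips, to which the pointwise hypothesis applies.
  have hflip : ∀ σ : Fin m → Bool, ∫ ω, F (flipPairs σ ω) ∂Q = ∫ ω, F ω ∂Q := fun σ => by
    have hmp : MeasurePreserving (flipPairs (Z := Z) σ) Q Q := measurePreserving_flipPairs D σ
    have h := integral_map (f := F) hmp.measurable.aemeasurable
      (hmp.map_eq.symm ▸ hFi.aestronglyMeasurable)
    rw [hmp.map_eq] at h
    exact h.symm
  have hflipi : ∀ σ : Fin m → Bool, Integrable (fun ω => F (flipPairs σ ω)) Q := fun σ =>
    (measurePreserving_flipPairs D σ).integrable_comp_of_integrable hFi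
  have hflip_eq : ∀ (σ : Fin m → Bool) (ω : Fin m → Z × Z), F (flipPairs σ ω) =
      ∑ t, coinSign (σ t) * (f (pick σ (fun i => (ω i).1) fun i => (ω i).2) (ω t).1 -
        f (pick σ (fun i => (ω i).1) fun i => (ω i).2) (ω t).2) := fun σ ω => by
    have hp : (fun i => (flipPairs σ ω i).1) = pick σ (fun i => (ω i).1) fun i => (ω i).2 := by
      funext i
      simp only [flipPairs, pick]
      split_ifs <;> rfl
    rw [hF]
    simp only [hp]
    refine Finset.sum_congr rfl fun t _ => ?_
    cases h : σ t <;> simp [flipPairs, coinSign, h]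
  have hae : ∀ᵐ ω ∂Q, ∀ t, good (ω t).1 ∧ good (ω t).2 := by
    rw [ae_all_iff]
    intro t
    have h1 : ∀ᵐ p ∂(D.prod D), good p.1 ∧ good p.2 :=
      ((Measure.quasiMeasurePreserving_fst (μ := D) (ν := D)).ae hgood).and
        ((Measure.quasiMeasurePreserving_snd (μ := D) (ν := D)).ae hgood)
    exact (measurePreserving_eval (fun _ : Fin m => D.prod D) t).quasiMeasurePreserving.ae h1
  have hsum : ∫ ω, ∑ σ : Fin m → Bool, F (flipPairs σ ω) ∂Q ≤ 2 ^ m * (m * β) := by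
    calc ∫ ω, ∑ σ : Fin m → Bool, F (flipPairs σ ω) ∂Q ≤ ∫ _, 2 ^ m * (m * β) ∂Q := by
          refine integral_mono_ae (integrable_finsetSum _ fun σ _ => hflipi σ)
            (integrable_const _) ?_
          filter_upwards [hae] with ω hω
          simp only [hflip_eq]
          exact hβ _ _ (fun t => (hω t).1) fun t => (hω t).2
      _ = 2 ^ m * (m * β) := by simp
  rw [integral_finsetSum _ fun σ _ => hflipi σ] at hsum
  simp only [hflip, Finset.sum_const, Finset.card_univ, Fintype.card_fun, Fintype.card_bool,
    Fintype.card_fin, nsmul_eq_mul, Nat.cast_pow, Nat.cast_ofNat] at hsum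
  have := le_of_mul_le_mul_left hsum (by positivity)
  linarith

/-- Choose the admissible index with the least code; the least code is a measurable function. -/
theorem exists_measurable_selection {X Φ : Type*} [MeasurableSpace X] [Finite Φ]
    {E : Φ → Set X} (hE : ∀ φ, MeasurableSet (E φ)) (hcover : ∀ x, ∃ φ, x ∈ E φ) :
    ∃ sel : X → Φ, (∀ x, x ∈ E (sel x)) ∧ ∀ φ, MeasurableSet {x | sel x = φ} := by
  classical
  obtain ⟨_⟩ := nonempty_encodable Φ
  let p : X → ℕ → Prop := fun x i => ∃ φ ∈ Encodable.decode (α := Φ) i, x ∈ E φ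
  have hp : ∀ x, ∃ i, p x i := fun x => by
    obtain ⟨φ, hφ⟩ := hcover x
    exact ⟨Encodable.encode φ, φ, by simp, hφ⟩
  have hpm : ∀ i, MeasurableSet {x | p x i} := fun i => by
    have : {x | p x i} = ⋃ φ ∈ {φ : Φ | φ ∈ Encodable.decode (α := Φ) i}, E φ := by
      ext x
      simp [p]
    rw [this]
    exact MeasurableSet.biUnion (Set.to_countable _) fun φ _ => hE φ
  have hfind : Measurable fun x => Nat.find (hp x) := measurable_find hp hpm
  choose sel hsel hmem using fun x => Nat.find_spec (hp x)
  refine ⟨sel, hmem, fun φ => ?_⟩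
  have : {x | sel x = φ} = {x | Nat.find (hp x) ∈
      {i | φ ∈ Encodable.decode (α := Φ) i}} := by
    ext x
    have hx := hsel x
    simp only [Set.mem_ofPred_eq, Option.mem_def] at hx ⊢
    rw [hx, Option.some_inj]
  rw [this]
  exact hfind (Set.to_countable _).measurableSet

end

end

noncomputable section

variable {n k m : ℕ}

/-! ### Learning by empirical revenue maximization -/

/-- The revenue of every auction of the class on the profile `v` is in `[0, 1]`. -/
def AuctionClass.Good (A : AuctionClass n k) (v : Profile n k) : Prop :=
  ∀ h, (A.mech h).revenue v ∈ Set.Icc (0 : ℝ) 1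

theorem empRevenue_map (A : AuctionClass n k) (s : Fin m → Profile n k) (h : A.Hyp) :
    A.empRevenue (Finset.univ.val.map s) h = (∑ t, (A.mech h).revenue (s t)) / m := by
  simp only [AuctionClass.empRevenue, Multiset.map_map, Multiset.card_map, Finset.card_val,
    Finset.card_univ, Fintype.card_fin]
  rfl

theorem sample_ne_zero {Z : Type*} (hm : 0 < m) (s : Fin m → Z) : Finset.univ.val.map s ≠ 0 := by
  intro h
  have := congrArg Multiset.card h
  simp only [Multiset.card_map, Finset.card_val, Finset.card_univ, Fintype.card_fin,
    Multiset.card_zero] at this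
  omega

theorem AuctionClass.IsTame.integrable_revenue {A : AuctionClass n k} (hA : A.IsTame)
    {D : Measure (Profile n k)} [IsFiniteMeasure D] (hD : ∀ᵐ v ∂D, A.Good v) (h : A.Hyp) :
    Integrable (A.mech h).revenue D :=
  Integrable.of_mem_Icc 0 1 (hA.measurable_revenue h).aemeasurable (hD.mono fun _ hv => hv h)

theorem AuctionClass.expRevenue_mem_unit {A : AuctionClass n k}
    {D : Measure (Profile n k)} [IsProbabilityMeasure D] (hD : ∀ᵐ v ∂D, A.Good v) (h : A.Hyp) :
    (A.mech h).expRevenue D ∈ Set.Icc (0 : ℝ) 1 := by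
  refine ⟨integral_nonneg_of_ae (hD.mono fun v hv => (hv h).1), ?_⟩
  have : ‖∫ v, (A.mech h).revenue v ∂D‖ ≤ 1 * D.real Set.univ :=
    norm_integral_le_of_norm_le_const (hD.mono fun v hv => by
      rw [Real.norm_of_nonneg (hv h).1]
      exact (hv h).2)
  rw [probReal_univ, mul_one] at this
  exact (Real.le_norm_self _).trans this

/-- Among the empirical maximizers with sample values, a worst one can be chosen measurably. -/
theorem AuctionClass.IsTame.exists_worst_maximizer {A : AuctionClass n k} (hA : A.IsTame)
    (D : Measure (Profile n k)) [IsProbabilityMeasure D] (hm : 0 < m) :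
    ∃ G : (Fin m → Profile n k) → A.Hyp,
      (∀ s, G s ∈ A.onSample (Finset.univ.val.map s)) ∧
      (∀ s, A.IsMaximizer (Finset.univ.val.map s) (G s)) ∧
      (∀ s, ∀ h ∈ A.onSample (Finset.univ.val.map s), A.IsMaximizer (Finset.univ.val.map s) h →
        (A.mech (G s)).expRevenue D ≤ (A.mech h).expRevenue D) ∧
      Measurable fun p : (Fin m → Profile n k) × Profile n k =>
        (A.mech (G p.1)).revenue p.2 := by
  classical
  obtain ⟨Φ, _, hyp, hon, hmeas⟩ := hA.indexed m
  have hon' : ∀ s φ, hyp φ s ∈ A.onSample (Finset.univ.val.map s) := fun s φ => by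
    rw [hon]
    exact ⟨φ, rfl⟩
  have hmE : ∀ φ, Measurable fun s => A.empRevenue (Finset.univ.val.map s) (hyp φ s) := fun φ => by
    simp only [empRevenue_map]
    exact (Finset.measurable_sum _ fun t _ =>
      (hmeas φ).comp (measurable_id.prodMk (measurable_pi_apply t))).div_const _
  have hmR : ∀ φ, Measurable fun s => (A.mech (hyp φ s)).expRevenue D := fun φ =>
    (hmeas φ).stronglyMeasurable.integral_prod_right.measurable
  let M : Φ → Set (Fin m → Profile n k) := fun φ =>
    ⋂ ψ, {s | A.empRevenue (Finset.univ.val.map s) (hyp ψ s) ≤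
      A.empRevenue (Finset.univ.val.map s) (hyp φ s)}
  have hM : ∀ φ, MeasurableSet (M φ) := fun φ =>
    MeasurableSet.iInter fun ψ => measurableSet_le (hmE ψ) (hmE φ)
  -- Comparing with the finitely many indexed hypotheses suffices, because one of them is a
  -- maximizer over the whole class.
  have hM_iff : ∀ s φ, s ∈ M φ ↔ A.IsMaximizer (Finset.univ.val.map s) (hyp φ s) := fun s φ => by
    simp only [M, Set.mem_iInter, Set.mem_ofPred_eq]
    refine ⟨fun H g => ?_, fun H ψ => H _⟩
    obtain ⟨h, hh, hmax⟩ := hA.exists_isMaximizer _ (sample_ne_zero hm s)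
    rw [hon] at hh
    obtain ⟨ψ, rfl⟩ := hh
    exact (hmax g).trans (H ψ)
  -- On `E φ` the index φ gives a maximizer, and no indexed maximizer earns less under `D`.
  let E : Φ → Set (Fin m → Profile n k) := fun φ => M φ ∩
    ⋂ ψ, ((M ψ)ᶜ ∪ {s | (A.mech (hyp φ s)).expRevenue D ≤ (A.mech (hyp ψ s)).expRevenue D})
  have hE : ∀ φ, MeasurableSet (E φ) := fun φ => (hM φ).inter
    (MeasurableSet.iInter fun ψ => (hM ψ).compl.union (measurableSet_le (hmR φ) (hmR ψ)))
  have hcover : ∀ s, ∃ φ, s ∈ E φ := fun s => by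
    obtain ⟨h, hh, hmax⟩ := hA.exists_isMaximizer _ (sample_ne_zero hm s)
    rw [hon] at hh
    obtain ⟨ψ, rfl⟩ := hh
    obtain ⟨φ, hφ, hmin⟩ := Finset.exists_min_image (Finset.univ.filter fun φ => s ∈ M φ)
      (fun φ => (A.mech (hyp φ s)).expRevenue D) ⟨ψ, by simpa using (hM_iff s ψ).2 hmax⟩
    simp only [Finset.mem_filter, Finset.mem_univ, true_and] at hφ hmin
    refine ⟨φ, hφ, Set.mem_iInter.2 fun ψ => ?_⟩
    by_cases hψ : s ∈ M ψ
    · exact Or.inr (hmin ψ hψ)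
    · exact Or.inl hψ
  obtain ⟨sel, hsel, hselm⟩ := exists_measurable_selection hE hcover
  refine ⟨fun s => hyp (sel s) s, fun s => hon' s _, fun s => (hM_iff s _).1 (hsel s).1,
    fun s h hh hmax => ?_, ?_⟩
  · rw [hon] at hh
    obtain ⟨ψ, rfl⟩ := hh
    exact (Set.mem_iInter.1 (hsel s).2 ψ).resolve_left fun h => h ((hM_iff s ψ).2 hmax)
  · have : (fun p : (Fin m → Profile n k) × Profile n k =>
        (A.mech (hyp (sel p.1) p.1)).revenue p.2) =
        fun p => ∑ φ, if sel p.1 = φ then (A.mech (hyp φ p.1)).revenue p.2 else 0 := by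
      funext p
      simp
    rw [this]
    exact Finset.measurable_sum _ fun φ _ =>
      Measurable.ite (measurable_fst (hselm φ)) (hmeas φ) measurable_const

/-- If the empirical deviation between the two halves of a double sample is at most `β` on average
over coin flips, then empirical revenue maximization loses at most `β`. -/
theorem AuctionClass.IsTame.optRevenue_le {A : AuctionClass n k} (hA : A.IsTame)
    {erm : Multiset (Profile n k) → A.Hyp} (herm : A.IsERM erm)
    {D : ProbabilityMeasure (Profile n k)} (hD : D ∈ A.unitRevenue) (hm : 0 < m) {β : ℝ}
    (hβ : ∀ s s' : Fin m → Profile n k, (∀ t, A.Good (s t)) → (∀ t, A.Good (s' t)) →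
      ∀ h : (Fin m → Bool) → A.Hyp,
      (∀ σ, h σ ∈ A.onSample (Finset.univ.val.map (pick σ s s'))) →
      ∑ σ : Fin m → Bool, ∑ t, coinSign (σ t) *
        ((A.mech (h σ)).revenue (s t) - (A.mech (h σ)).revenue (s' t)) ≤ 2 ^ m * (m * β)) :
    ENNReal.ofReal (A.optRevenue D) ≤ A.learnedRevenue erm D m + ENNReal.ofReal β := by
  have hgood : ∀ᵐ v ∂(D : Measure (Profile n k)), A.Good v := hD
  obtain ⟨G, hGon, hGmax, hGmin, hGmeas⟩ :=
    hA.exists_worst_maximizer (m := m) (D : Measure (Profile n k)) hm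
  -- Revenue is bounded only almost surely; clamping makes it bounded everywhere and changes nothing
  -- on good profiles.
  set f : (Fin m → Profile n k) → Profile n k → ℝ := fun s v =>
    max 0 (min 1 ((A.mech (G s)).revenue v)) with hf
  have hfm : Measurable fun p : (Fin m → Profile n k) × Profile n k => f p.1 p.2 :=
    measurable_const.max (measurable_const.min hGmeas)
  have hf01 : ∀ s v, f s v ∈ Set.Icc (0 : ℝ) 1 := fun s v =>
    ⟨le_max_left _ _, max_le zero_le_one (min_le_left _ _)⟩
  have hf_eq : ∀ s v, A.Good v → f s v = (A.mech (G s)).revenue v := fun s v hv => by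
    simp only [hf]
    rw [min_eq_right (hv _).2, max_eq_right (hv _).1]
  have hsym := symmetrization (D := (D : Measure (Profile n k))) hfm hf01 hgood (β := β) (by
    intro s s' hs hs'
    simp only [hf_eq _ _ (hs _), hf_eq _ _ (hs' _)]
    exact hβ s s' hs hs' (fun σ => G (pick σ s s')) fun σ => hGon _)
  have hR : ∀ s, ∫ v, f s v ∂(D : Measure (Profile n k)) = (A.mech (G s)).expRevenue D :=
    fun s => integral_congr_ae (hgood.mono fun v hv => hf_eq s v hv)
  have hm' : (0 : ℝ) < m := Nat.cast_pos.2 hm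
  have hopt : ∀ h, (A.mech h).expRevenue D ≤
      ∫ s, ∫ v, f s v ∂D ∂(Measure.pi fun _ : Fin m => (D : Measure (Profile n k))) + β := by
    intro h
    have hi := hA.integrable_revenue hgood h
    have heval := fun t : Fin m =>
      measurePreserving_eval (fun _ : Fin m => (D : Measure (Profile n k))) t
    have h1 : ∀ t : Fin m, ∫ s, (A.mech h).revenue (s t)
        ∂(Measure.pi fun _ : Fin m => (D : Measure (Profile n k))) = (A.mech h).expRevenue D := by
      intro t
      have := integral_map (f := (A.mech h).revenue) (heval t).measurable.aemeasurable
        ((heval t).map_eq.symm ▸ hi.aestronglyMeasurable)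
      rw [(heval t).map_eq] at this
      exact this.symm
    have hi' : ∀ t : Fin m, Integrable (fun s : Fin m → Profile n k => (A.mech h).revenue (s t))
        (Measure.pi fun _ : Fin m => (D : Measure (Profile n k))) := fun t =>
      (heval t).integrable_comp_of_integrable hi
    have h2 : ∫ s, ∑ t, (A.mech h).revenue (s t)
        ∂(Measure.pi fun _ : Fin m => (D : Measure (Profile n k))) ≤
        ∫ s, ∑ t, f s (s t) ∂(Measure.pi fun _ : Fin m => (D : Measure (Profile n k))) := by
      refine integral_mono_ae (integrable_finsetSum _ fun t _ => hi' t)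
        (integrable_finsetSum _ fun t _ => integrable_of_mem_unit
          (hfm.comp (measurable_id.prodMk (measurable_pi_apply t))) fun s => hf01 _ _) ?_
      have hall : ∀ᵐ s ∂(Measure.pi fun _ : Fin m => (D : Measure (Profile n k))),
          ∀ t, A.Good (s t) := by
        rw [ae_all_iff]
        exact fun t => (heval t).quasiMeasurePreserving.ae hgood
      filter_upwards [hall] with s hs
      simp only [hf_eq _ _ (hs _)]
      have := hGmax s h
      rw [empRevenue_map, empRevenue_map] at this
      exact (div_le_div_iff_of_pos_right hm').1 this
    rw [integral_finsetSum _ fun t _ => hi' t] at h2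
    simp only [h1, Finset.sum_const, Finset.card_univ, Fintype.card_fin, nsmul_eq_mul] at h2
    have h3 := h2.trans hsym
    rw [← mul_add] at h3
    exact le_of_mul_le_mul_left h3 hm'
  -- Nonemptiness is needed to bound the real supremum `optRevenue` by `ciSup_le`; the output on the
  -- empty sample serves as a witness.
  have : Nonempty A.Hyp := ⟨erm 0⟩
  -- The process `erm` need not be measurable. The worst maximizer is, and it bounds the output of
  -- `erm` from below pointwise.
  have hlearn : ENNReal.ofReal (∫ s, ∫ v, f s v ∂D
      ∂(Measure.pi fun _ : Fin m => (D : Measure (Profile n k)))) ≤ A.learnedRevenue erm D m := by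
    have hint : Measurable fun s => ∫ v, f s v ∂(D : Measure (Profile n k)) :=
      hfm.stronglyMeasurable.integral_prod_right.measurable
    have h01 : ∀ s, ∫ v, f s v ∂(D : Measure (Profile n k)) ∈ Set.Icc (0 : ℝ) 1 := fun s => by
      rw [hR]
      exact expRevenue_mem_unit hgood _
    rw [ofReal_integral_eq_lintegral_ofReal (integrable_of_mem_unit hint h01)
      (Filter.Eventually.of_forall fun s => (h01 s).1)]
    refine lintegral_mono fun s => ENNReal.ofReal_le_ofReal ?_
    rw [hR]
    exact hGmin s _ (hA.ermOnSample.2 erm herm _ (sample_ne_zero hm s)) (herm.isMaximizer _ (sample_ne_zero hm s))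
  calc ENNReal.ofReal (A.optRevenue D) ≤ ENNReal.ofReal (∫ s, ∫ v, f s v ∂D
        ∂(Measure.pi fun _ : Fin m => (D : Measure (Profile n k))) + β) :=
        ENNReal.ofReal_le_ofReal (ciSup_le hopt)
    _ ≤ _ := ENNReal.ofReal_add_le.trans (add_le_add_left hlearn _)

end

noncomputable section

/-! ### Maxima of random signed sums -/

/-- The moment generating function factors over the independent coins, and cosh x ≤ exp(x² / 2). -/
theorem sum_exp_coinSign_le {m : ℕ} (a : Fin m → ℝ) :
    ∑ σ : Fin m → Bool, Real.exp (∑ t, coinSign (σ t) * a t) ≤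
      2 ^ m * Real.exp ((∑ t, a t ^ 2) / 2) := by
  have h1 : ∑ σ : Fin m → Bool, Real.exp (∑ t, coinSign (σ t) * a t) =
      ∏ t, ∑ c : Bool, Real.exp (coinSign c * a t) := by
    rw [Finset.prod_univ_sum, Fintype.piFinset_univ]
    simp only [Real.exp_sum]
  have h2 : ∀ t, ∑ c : Bool, Real.exp (coinSign c * a t) = 2 * Real.cosh (a t) := fun t => by
    simp only [Fintype.sum_bool, coinSign, Real.cosh_eq]
    norm_num
    ring
  rw [h1, Finset.sum_div, Real.exp_sum]
  calc ∏ t, ∑ c : Bool, Real.exp (coinSign c * a t) ≤ ∏ t, (2 * Real.exp (a t ^ 2 / 2)) := by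
        refine Finset.prod_le_prod (fun t _ => Finset.sum_nonneg fun c _ => (Real.exp_pos _).le)
          fun t _ => ?_
        rw [h2]
        exact mul_le_mul_of_nonneg_left (Real.cosh_le_exp_half_sq _) two_pos.le
    _ = _ := by simp [Finset.prod_mul_distrib]

/-- **Massart's lemma**, with an explicit parameter `c`. -/
theorem massart {m : ℕ} (V : Finset (Fin m → ℝ)) {K W c : ℝ} (hK : (V.card : ℝ) ≤ Real.exp K)
    (hW : ∀ a ∈ V, ∑ t, a t ^ 2 ≤ W) (hc : 0 < c) (a : (Fin m → Bool) → Fin m → ℝ)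
    (ha : ∀ σ, a σ ∈ V) :
    ∑ σ, ∑ t, coinSign (σ t) * a σ t ≤ 2 ^ m * ((K + c ^ 2 * W / 2) / c) := by
  set L := K + c ^ 2 * W / 2 with hL
  -- The tangent to the logarithm at exp L takes the place of Jensen's inequality: y ≤ L - 1 + exp(y
  -- - L).
  have h1 : ∀ σ, c * ∑ t, coinSign (σ t) * a σ t ≤
      L - 1 + Real.exp (-L) * Real.exp (c * ∑ t, coinSign (σ t) * a σ t) := fun σ => by
    have := Real.add_one_le_exp (-L + c * ∑ t, coinSign (σ t) * a σ t)
    rw [Real.exp_add] at this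
    linarith
  have h2 : ∑ σ, Real.exp (c * ∑ t, coinSign (σ t) * a σ t) ≤ 2 ^ m * Real.exp L := by
    calc ∑ σ, Real.exp (c * ∑ t, coinSign (σ t) * a σ t)
        ≤ ∑ σ : Fin m → Bool, ∑ b ∈ V, Real.exp (∑ t, coinSign (σ t) * (c * b t)) := by
          refine Finset.sum_le_sum fun σ _ => ?_
          have : c * ∑ t, coinSign (σ t) * a σ t = ∑ t, coinSign (σ t) * (c * a σ t) := by
            rw [Finset.mul_sum]
            exact Finset.sum_congr rfl fun t _ => by ring
          rw [this]
          exact Finset.single_le_sum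
            (f := fun b : Fin m → ℝ => Real.exp (∑ t, coinSign (σ t) * (c * b t)))
            (fun b _ => (Real.exp_pos _).le) (ha σ)
      _ = ∑ b ∈ V, ∑ σ : Fin m → Bool, Real.exp (∑ t, coinSign (σ t) * (c * b t)) :=
          Finset.sum_comm
      _ ≤ ∑ _b ∈ V, 2 ^ m * Real.exp (c ^ 2 * W / 2) := by
          refine Finset.sum_le_sum fun b hb => (sum_exp_coinSign_le _).trans ?_
          have h3 : ∑ t, (c * b t) ^ 2 ≤ c ^ 2 * W := by
            simp only [mul_pow, ← Finset.mul_sum]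
            exact mul_le_mul_of_nonneg_left (hW b hb) (sq_nonneg c)
          gcongr
      _ = 2 ^ m * (V.card * Real.exp (c ^ 2 * W / 2)) := by
          rw [Finset.sum_const, nsmul_eq_mul]
          ring
      _ ≤ 2 ^ m * (Real.exp K * Real.exp (c ^ 2 * W / 2)) := by gcongr
      _ = 2 ^ m * Real.exp L := by rw [hL, Real.exp_add]
  have h4 : c * ∑ σ, ∑ t, coinSign (σ t) * a σ t ≤ 2 ^ m * L := by
    calc c * ∑ σ, ∑ t, coinSign (σ t) * a σ t
        ≤ ∑ σ : Fin m → Bool,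
          (L - 1 + Real.exp (-L) * Real.exp (c * ∑ t, coinSign (σ t) * a σ t)) := by
          rw [Finset.mul_sum]
          exact Finset.sum_le_sum fun σ _ => h1 σ
      _ = 2 ^ m * (L - 1) +
          Real.exp (-L) * ∑ σ, Real.exp (c * ∑ t, coinSign (σ t) * a σ t) := by
          rw [Finset.sum_add_distrib, ← Finset.mul_sum]
          simp
          ring
      _ ≤ 2 ^ m * (L - 1) + Real.exp (-L) * (2 ^ m * Real.exp L) := by gcongr
      _ = 2 ^ m * L := by
          rw [mul_left_comm, ← Real.exp_add]
          simp
          ring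
  rw [← mul_div_assoc, le_div_iff₀ hc]
  linarith

/-! ### Learning guarantee from split-sample growth -/

variable {n k m : ℕ}

/-- Empirical revenue maximization loses at most `√(2 log N / m)` if a double sample admits at
most `N` auctions with sample values. -/
theorem AuctionClass.IsTame.optRevenue_le_of_encard {A : AuctionClass n k} (hA : A.IsTame)
    {erm : Multiset (Profile n k) → A.Hyp} (herm : A.IsERM erm)
    {D : ProbabilityMeasure (Profile n k)} (hD : D ∈ A.unitRevenue) (hm : 0 < m) {N : ℕ}
    (hN : 2 ≤ N)
    (hcard : ∀ S : Multiset (Profile n k), S.card = 2 * m → (A.onSample S).encard ≤ N) :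
    ENNReal.ofReal (A.optRevenue D) ≤
      A.learnedRevenue erm D m + ENNReal.ofReal (Real.sqrt (2 * Real.log N / m)) := by
  classical
  refine hA.optRevenue_le herm hD hm fun s s' hs hs' h hh => ?_
  set S : Multiset (Profile n k) := Finset.univ.val.map s + Finset.univ.val.map s' with hS
  have hScard : S.card = 2 * m := by
    simp only [hS, Multiset.card_add, Multiset.card_map, Finset.card_val, Finset.card_univ,
      Fintype.card_fin]
    ring
  have hfin : (A.onSample S).Finite := Set.finite_of_encard_le_coe (hcard S hScard)
  set a : A.Hyp → Fin m → ℝ := fun g t => (A.mech g).revenue (s t) - (A.mech g).revenue (s' t)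
  have hmS : ∀ σ, h σ ∈ A.onSample S := fun σ => by
    refine hA.onSample_mono (fun v hv => ?_) (hh σ)
    obtain ⟨t, -, rfl⟩ := Multiset.mem_map.1 hv
    rw [hS, Multiset.mem_add]
    unfold pick
    split_ifs
    · exact Or.inl (Multiset.mem_map_of_mem _ (Finset.mem_univ t))
    · exact Or.inr (Multiset.mem_map_of_mem _ (Finset.mem_univ t))
  have hN0 : (0 : ℝ) < N := by exact_mod_cast (by omega : 0 < N)
  have hlog : 0 < Real.log N := Real.log_pos (by exact_mod_cast hN)
  have hm' : (0 : ℝ) < m := Nat.cast_pos.2 hm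
  -- This c minimizes (log N + c² m / 2) / c, and the minimum is m c.
  have hc : 0 < Real.sqrt (2 * Real.log N / m) := Real.sqrt_pos.2 (by positivity)
  have hV : ((hfin.toFinset.image a).card : ℝ) ≤ Real.exp (Real.log N) := by
    rw [Real.exp_log hN0]
    have h1 : (hfin.toFinset.card : ℕ∞) ≤ N := by
      rw [← hfin.encard_eq_coe_toFinset_card]
      exact hcard S hScard
    exact_mod_cast Finset.card_image_le.trans (by exact_mod_cast h1)
  have hmass := massart (hfin.toFinset.image a) hV (W := m) (fun b hb => by
    obtain ⟨g, -, rfl⟩ := Finset.mem_image.1 hb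
    calc ∑ t, a g t ^ 2 ≤ ∑ _t : Fin m, (1 : ℝ) := Finset.sum_le_sum fun t _ => by
          rw [sq_le_one_iff_abs_le_one, abs_le]
          have h1 := hs t g
          have h2 := hs' t g
          constructor <;> simp only [a] <;> linarith [h1.1, h1.2, h2.1, h2.2]
      _ = m := by simp) hc (fun σ => a (h σ)) fun σ =>
      Finset.mem_image_of_mem _ (hfin.mem_toFinset.2 (hmS σ))
  refine hmass.trans (le_of_eq ?_)
  have hsq : Real.sqrt (2 * Real.log N / m) ^ 2 = 2 * Real.log N / m :=
    Real.sq_sqrt (by positivity)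
  congr 1
  rw [div_eq_iff hc.ne', mul_assoc, ← sq, hsq]
  field_simp
  ring

end

noncomputable section

variable {n k m : ℕ} {rule : SaleRule}

/-! ### Level sets of the revenue from one good -/

open Classical in
/-- The sample points on which prices `q` raise at least `u`. -/
def levelSet (rule : SaleRule) (b : Fin m → Fin n → ℝ≥0) (u : ℝ≥0) (q : Fin n → ℝ≥0) :
    Finset (Fin m) :=
  Finset.univ.filter fun t => u ≤ goodRevenue rule q (b t)

theorem mem_levelSet {b : Fin m → Fin n → ℝ≥0} {u : ℝ≥0} {q : Fin n → ℝ≥0} {t : Fin m} :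
    t ∈ levelSet rule b u q ↔ u ≤ goodRevenue rule q (b t) := by
  classical
  simp [levelSet]

/-- The level sets have Vapnik-Chervonenkis dimension at most `2 n`. -/
theorem card_le_of_shatters {b : Fin m → Fin n → ℝ≥0} {u : ℝ≥0} (hu : 0 < u)
    {𝒜 : Finset (Finset (Fin m))} (h𝒜 : ∀ B ∈ 𝒜, ∃ q, B = levelSet rule b u q)
    {s : Finset (Fin m)} (hs : 𝒜.Shatters s) : s.card ≤ 2 * n := by
  classical
  by_contra! hcard
  -- Only singletons are cut out: for each t there are prices that raise u at t and at no other
  -- point of s.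
  have h1 : ∀ t : s, ∃ q, s ∩ levelSet rule b u q = {t.1} := fun t => by
    obtain ⟨B, hB, hst⟩ := hs.exists_inter_eq_singleton t.2
    obtain ⟨q, rfl⟩ := h𝒜 B hB
    exact ⟨q, hst⟩
  choose q hq using h1
  have hmem : ∀ t t' : s, t'.1 ∈ levelSet rule b u (q t) ↔ t' = t := fun t t' => by
    have := Finset.ext_iff.1 (hq t) t'.1
    rw [Finset.mem_inter, Finset.mem_singleton, and_iff_right t'.2] at this
    exact this.trans Subtype.ext_iff.symm
  have h2 : ∀ t : s, ∃ i, Secures rule u (q t i) (b t) i := fun t =>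
    (le_goodRevenue_iff hu).1 (mem_levelSet.1 ((hmem t t).2 rfl))
  choose i hi using h2
  -- Pigeonhole on the 2n pairs of the securing bidder and whether her price alone reaches u.
  obtain ⟨t, t', hne, heq⟩ := Fintype.exists_ne_map_eq_of_card_lt
    (fun t : s => (i t, decide (u ≤ q t (i t)))) (by
      simp only [Fintype.card_prod, Fintype.card_fin, Fintype.card_bool, Fintype.card_coe]
      omega)
  simp only [Prod.mk.injEq, decide_eq_decide] at heq
  -- For two points in one box, the lower of the two prices secures u at both, so the prices made
  -- for one point also raise u at the other.
  have key : ∀ t t' : s, t ≠ t' → i t = i t' → (u ≤ q t (i t) ↔ u ≤ q t' (i t')) →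
      q t (i t) ≤ q t' (i t') → False := fun t t' hne h1 h2 h3 => by
    have h4 : Secures rule u (q t (i t)) (b t') (i t) := by
      rw [h1] at h3 ⊢
      exact (hi t').anti h3 fun h => h1 ▸ h2.2 h
    exact hne ((hmem t t').1 (mem_levelSet.2 ((le_goodRevenue_iff hu).2 ⟨_, h4⟩))).symm
  rcases le_total (q t (i t)) (q t' (i t')) with h | h
  · exact key t t' hne heq.1 heq.2 h
  · exact key t' t hne.symm heq.1.symm heq.2.symm h

/-- A Sauer-Shelah bound with a free parameter. A family has at most as many members as it shatters
sets; weighting a shattered set s by p ^ |s| ≥ p ^ d and summing over all subsets of X gives at most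
(1 + p) ^ |X| ≤ exp(p |X|). -/
theorem card_le_exp_of_shatters {X : Finset (Fin m)} {d : ℕ} {𝒜 : Finset (Finset (Fin m))}
    (hX : ∀ B ∈ 𝒜, B ⊆ X) (hd : ∀ s, 𝒜.Shatters s → s.card ≤ d) {p : ℝ} (hp : 0 < p)
    (hp1 : p ≤ 1) : (𝒜.card : ℝ) ≤ Real.exp (d * Real.log (1 / p) + p * X.card) := by
  have h1 : (𝒜.card : ℝ) ≤ 𝒜.shatterer.card := by exact_mod_cast 𝒜.card_le_card_shatterer
  have h2 : 𝒜.shatterer ⊆ X.powerset := fun s hs => by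
    obtain ⟨B, hB, hsB⟩ := (Finset.mem_shatterer.1 hs).exists_superset
    exact Finset.mem_powerset.2 (hsB.trans (hX B hB))
  have h3 : p ^ d * 𝒜.shatterer.card ≤ (1 + p) ^ X.card := by
    calc p ^ d * 𝒜.shatterer.card = ∑ s ∈ 𝒜.shatterer, p ^ d := by
          rw [Finset.sum_const, nsmul_eq_mul, mul_comm]
      _ ≤ ∑ s ∈ 𝒜.shatterer, p ^ s.card := Finset.sum_le_sum fun s hs =>
          pow_le_pow_of_le_one hp.le hp1 (hd s (Finset.mem_shatterer.1 hs))
      _ ≤ ∑ s ∈ X.powerset, p ^ s.card :=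
          Finset.sum_le_sum_of_subset_of_nonneg h2 fun s _ _ => (pow_pos hp _).le
      _ = (1 + p) ^ X.card := by
          rw [add_comm, ← Finset.sum_pow_mul_eq_add_pow]
          simp
  have h4 : (1 + p) ^ X.card ≤ Real.exp (p * X.card) := by
    rw [mul_comm, Real.exp_nat_mul]
    exact pow_le_pow_left₀ (by positivity) (by linarith [Real.add_one_le_exp p]) _
  have h5 : Real.exp (d * Real.log (1 / p)) = (p ^ d)⁻¹ := by
    rw [Real.exp_nat_mul, Real.exp_log (by positivity), one_div, inv_pow]
  rw [Real.exp_add, h5, inv_mul_eq_div, le_div_iff₀ (pow_pos hp _)]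
  calc (𝒜.card : ℝ) * p ^ d ≤ p ^ d * 𝒜.shatterer.card := by
        rw [mul_comm]
        gcongr
    _ ≤ _ := h3.trans h4

/-- Massart's lemma for the indicators of level sets. Points whose top bid is below u lie in no
level set, so x rather than m bounds both the variance and the entropy. -/
theorem sum_coinSign_levelSet_le (b : Fin m → Fin n → ℝ≥0) {u : ℝ≥0} (hu : 0 < u)
    (q : (Fin m → Bool) → Fin n → ℝ≥0) {x : ℝ}
    (hx : x = (Finset.univ.filter fun t => u ≤ Finset.univ.sup (b t)).card) {p c : ℝ} (hp : 0 < p)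
    (hp1 : p ≤ 1) (hc : 0 < c) :
    ∑ σ : Fin m → Bool, ∑ t, coinSign (σ t) *
        (if u ≤ goodRevenue rule (q σ) (b t) then (1 : ℝ) else 0) ≤
      2 ^ m * ((2 * n * Real.log (1 / p) + p * x + c ^ 2 * x / 2) / c) := by
  classical
  subst hx
  set X := Finset.univ.filter fun t => u ≤ Finset.univ.sup (b t) with hX
  set 𝒜 : Finset (Finset (Fin m)) := Finset.univ.image fun σ => levelSet rule b u (q σ) with h𝒜
  have hsub : ∀ B ∈ 𝒜, B ⊆ X := fun B hB t ht => by
    obtain ⟨σ, -, rfl⟩ := Finset.mem_image.1 hB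
    rw [hX, Finset.mem_filter]
    exact ⟨Finset.mem_univ _, (mem_levelSet.1 ht).trans (goodRevenue_le_sup _ _ _)⟩
  have hcard := card_le_exp_of_shatters (d := 2 * n) hsub (fun s hs =>
    card_le_of_shatters (rule := rule) (b := b) hu (fun B hB => by
      obtain ⟨σ, -, rfl⟩ := Finset.mem_image.1 hB
      exact ⟨_, rfl⟩) hs) hp hp1
  push_cast at hcard
  set ind : Finset (Fin m) → Fin m → ℝ := fun B t => if t ∈ B then 1 else 0 with hind
  have hmass := massart (𝒜.image ind) (K := 2 * n * Real.log (1 / p) + p * X.card) (W := X.card)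
    ((Nat.cast_le.2 Finset.card_image_le).trans hcard) (fun a ha => by
      obtain ⟨B, hB, rfl⟩ := Finset.mem_image.1 ha
      have : ∑ t, ind B t ^ 2 = B.card := by simp [hind, ite_pow]
      rw [this]
      exact_mod_cast Finset.card_le_card (hsub B hB)) hc (fun σ => ind (levelSet rule b u (q σ)))
      fun σ => Finset.mem_image_of_mem _ (Finset.mem_image_of_mem _ (Finset.mem_univ σ))
  simpa only [hind, mem_levelSet] using hmass

/-! ### Signed sums of revenues -/

/-- Here w is the fourth root of the level, and the choices are p = δ² w⁴ and c = δ w² in the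
level-set bound, while the present c stands for n times the number of goods. The term log(1/w) ≤ 1/w
costs one power of w, hence w³ and not w² in the denominator. The entropy contributes 20 and the
terms with X at most 2 to the constant 22. -/
theorem level_tradeoff {w δ X M c : ℝ} (hw : 0 < w) (hw1 : w ≤ 1) (hδ : 0 < δ)
    (hlog : 1 / 2 ≤ Real.log (1 / δ)) (hX : w ^ 4 * X ≤ M)
    (hc0 : 0 ≤ c) (hM : c * Real.log (1 / δ) / δ ^ 2 ≤ M) :
    (2 * c * Real.log (1 / (δ ^ 2 * w ^ 4)) + δ ^ 2 * w ^ 4 * X + (δ * w ^ 2) ^ 2 * X / 2) /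
      (δ * w ^ 2) ≤ M * (22 * δ) / w ^ 3 := by
  have hM0 : 0 ≤ M := le_trans (by positivity) hM
  set Λ := Real.log (1 / δ) with hΛ
  have hlogeq : Real.log (1 / (δ ^ 2 * w ^ 4)) = 2 * Λ + 4 * Real.log (1 / w) := by
    rw [hΛ, one_div, one_div, one_div, Real.log_inv, Real.log_inv, Real.log_inv,
      Real.log_mul (by positivity) (by positivity), Real.log_pow, Real.log_pow]
    push_cast
    ring
  have hlw : Real.log (1 / w) ≤ 1 / w := by
    have := Real.log_le_sub_one_of_pos (x := 1 / w) (by positivity)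
    linarith
  have h1 : w * Real.log (1 / w) ≤ 1 := by
    calc w * Real.log (1 / w) ≤ w * (1 / w) := by gcongr
      _ = 1 := by field_simp
  have hc : c * Λ ≤ M * δ ^ 2 := by rwa [div_le_iff₀ (by positivity)] at hM
  have hc2 : c ≤ 2 * (M * δ ^ 2) := by nlinarith
  have hMδ : 0 ≤ M * δ ^ 2 := by positivity
  rw [hlogeq, div_le_div_iff₀ (by positivity) (by positivity)]
  have e1 : (2 * c * (2 * Λ + 4 * Real.log (1 / w))) * w ≤ 20 * (M * δ ^ 2) := by
    have a1 : c * Λ * w ≤ M * δ ^ 2 := by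
      calc c * Λ * w ≤ M * δ ^ 2 * 1 := mul_le_mul hc hw1 hw.le hMδ
        _ = _ := mul_one _
    have a2 : c * (w * Real.log (1 / w)) ≤ 2 * (M * δ ^ 2) :=
      (mul_le_of_le_one_right hc0 h1).trans hc2
    nlinarith
  have e2 : (δ ^ 2 * w ^ 4 * X + (δ * w ^ 2) ^ 2 * X / 2) * w ≤ 2 * (M * δ ^ 2) := by
    have a1 : w ^ 4 * X * w ≤ M := by
      rcases le_total 0 (w ^ 4 * X) with h | h
      · exact (mul_le_of_le_one_right h hw1).trans hX
      · exact (mul_nonpos_of_nonpos_of_nonneg h hw.le).trans hM0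
    nlinarith [mul_le_mul_of_nonneg_left a1 (sq_nonneg δ)]
  have e3 := mul_le_mul_of_nonneg_right (add_le_add e1 e2) (sq_nonneg w)
  linarith

theorem intervalIntegral_indicator_le {r : ℝ} (h0 : 0 ≤ r) (h1 : r ≤ 1) :
    ∫ u in (0 : ℝ)..1, (if u ≤ r then (1 : ℝ) else 0) = r := by
  have : (fun u : ℝ => if u ≤ r then (1 : ℝ) else 0) = (Set.Iic r).indicator 1 := by
    ext u
    simp [Set.indicator_apply]
  rw [intervalIntegral.integral_of_le zero_le_one, this,
    integral_indicator_one measurableSet_Iic, Measure.real, Measure.restrict_apply measurableSet_Iic,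
    Set.Iic_inter_Ioc_of_le h1]
  simp [h0]

theorem intervalIntegrable_indicator_le (r : ℝ) :
    IntervalIntegrable (fun u : ℝ => if u ≤ r then (1 : ℝ) else 0) volume 0 1 := by
  have : (fun u : ℝ => if u ≤ r then (1 : ℝ) else 0) = (Set.Iic r).indicator 1 := by
    ext u
    simp [Set.indicator_apply]
  rw [this, intervalIntegrable_iff, Set.uIoc_of_le zero_le_one]
  exact (integrable_const (1 : ℝ)).indicator measurableSet_Iic

end

noncomputable section

variable {n k m : ℕ} {rule : SaleRule}

/-! ### Rademacher averages of pricing classes -/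

theorem intervalIntegrable_fun_sum {ι : Type*} {s : Finset ι} {f : ι → ℝ → ℝ} {a b : ℝ}
    (h : ∀ i ∈ s, IntervalIntegrable (f i) volume a b) :
    IntervalIntegrable (fun x => ∑ i ∈ s, f i x) volume a b := by
  have := IntervalIntegrable.sum s h
  rwa [← Finset.sum_fn]

/-- The Rademacher average of the class on good samples of size `m` is at most `β`. -/
def AuctionClass.RademacherLE (A : AuctionClass n k) (m : ℕ) (β : ℝ) : Prop :=
  ∀ z : Fin m → Profile n k, (∀ t, A.Good (z t)) → ∀ h : (Fin m → Bool) → A.Hyp,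
    ∑ σ : Fin m → Bool, ∑ t, coinSign (σ t) * (A.mech (h σ)).revenue (z t) ≤ 2 ^ m * (m * β)

/-- Price every good at its top bid. This price depends only on the good, so it is available in
anonymous classes too. -/
theorem Presentation.sum_sup_bid_le_one {A : AuctionClass n k} (P : Presentation rule A)
    {v : Profile n k} (hv : A.Good v) :
    ∑ j, ((Finset.univ.sup (P.bid j v) : ℝ≥0) : ℝ) ≤ 1 := by
  refine le_trans ?_ (hv (P.price.symm fun a => Finset.univ.sup (P.bid (P.good a) v))).2
  rw [P.revenue_eq]
  refine Finset.sum_le_sum fun j _ => ?_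
  simp only [Equiv.apply_symm_apply, P.good_slot]
  exact_mod_cast sup_le_goodRevenue rule (P.bid j v)

/-- On good profiles all bids are at most 1, so nobody buys at price 2. -/
theorem Presentation.exists_null {A : AuctionClass n k} (P : Presentation rule A) :
    ∃ h, ∀ v, A.Good v → (A.mech h).revenue v = 0 := by
  refine ⟨P.price.symm fun _ => 2, fun v hv => ?_⟩
  rw [P.revenue_eq]
  refine Finset.sum_eq_zero fun j _ => ?_
  rw [goodRevenue_eq_zero, NNReal.coe_zero]
  intro i
  rw [Equiv.apply_symm_apply]
  have h1 : (Finset.univ.sup (P.bid j v) : ℝ≥0) ≤ 1 := by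
    have := Finset.single_le_sum (f := fun j => ((Finset.univ.sup (P.bid j v) : ℝ≥0) : ℝ))
      (fun _ _ => NNReal.coe_nonneg _) (Finset.mem_univ j)
    exact_mod_cast this.trans (P.sum_sup_bid_le_one hv)
  exact ((Finset.le_sup (f := P.bid j v) (Finset.mem_univ i)).trans h1).trans_lt one_lt_two

/-- Split the revenue into levels u, bound the signed sum of indicators at each level, and
integrate. The goods share one budget of top bids per sample point, so their number enters only
through the entropy term n K log(1/δ). -/
theorem Presentation.rademacherLE {A : AuctionClass n k} (P : Presentation rule A) {δ : ℝ}
    (hδ : 0 < δ) (hlog : 1 / 2 ≤ Real.log (1 / δ))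
    (hm : (n * P.K : ℝ) * Real.log (1 / δ) / δ ^ 2 ≤ m) : A.RademacherLE m (88 * δ) := by
  classical
  intro z hz h
  have hδ1 : δ ≤ 1 := by
    by_contra! h1
    have : Real.log (1 / δ) ≤ 0 := Real.log_nonpos (by positivity) (by
      rw [div_le_one hδ]
      exact h1.le)
    linarith
  set g : (Fin m → Bool) → Fin m → Fin P.K → ℝ≥0 := fun σ t j =>
    goodRevenue rule (fun i => P.price (h σ) (P.slot i j)) (P.bid j (z t)) with hg
  set w : Fin m → Fin P.K → ℝ≥0 := fun t j => Finset.univ.sup (P.bid j (z t)) with hw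
  have hwsum : ∀ t, ∑ j, (w t j : ℝ) ≤ 1 := fun t => P.sum_sup_bid_le_one (hz t)
  have hg1 : ∀ σ t j, (g σ t j : ℝ) ≤ 1 := fun σ t j =>
    (NNReal.coe_le_coe.2 (goodRevenue_le_sup _ _ _)).trans
      ((Finset.single_le_sum (f := fun j => (w t j : ℝ))
        (fun _ _ => NNReal.coe_nonneg _) (Finset.mem_univ j)).trans (hwsum t))
  set Ψ : ℝ → ℝ := fun u => ∑ j, ∑ σ : Fin m → Bool, ∑ t, coinSign (σ t) *
    (if u ≤ g σ t j then (1 : ℝ) else 0) with hΨ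
  have hint : ∀ σ t j, IntervalIntegrable
      (fun u : ℝ => coinSign (σ t) * (if u ≤ g σ t j then (1 : ℝ) else 0)) volume 0 1 :=
    fun σ t j => (intervalIntegrable_indicator_le _).const_mul _
  have hΨint : IntervalIntegrable Ψ volume 0 1 := by
    refine intervalIntegrable_fun_sum fun j _ => intervalIntegrable_fun_sum fun σ _ =>
      intervalIntegrable_fun_sum fun t _ => hint σ t j
  have hΨeq : ∑ σ : Fin m → Bool, ∑ t, coinSign (σ t) * (A.mech (h σ)).revenue (z t) =
      ∫ u in (0 : ℝ)..1, Ψ u := by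
    have h1 : ∫ u in (0 : ℝ)..1, Ψ u = ∑ j, ∑ σ : Fin m → Bool, ∑ t,
        coinSign (σ t) * (g σ t j : ℝ) := by
      rw [hΨ, intervalIntegral.integral_finsetSum fun j _ => intervalIntegrable_fun_sum
        fun σ _ => intervalIntegrable_fun_sum fun t _ => hint σ t j]
      refine Finset.sum_congr rfl fun j _ => ?_
      rw [intervalIntegral.integral_finsetSum fun σ _ => intervalIntegrable_fun_sum
        fun t _ => hint σ t j]
      refine Finset.sum_congr rfl fun σ _ => ?_
      rw [intervalIntegral.integral_finsetSum fun t _ => hint σ t j]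
      refine Finset.sum_congr rfl fun t _ => ?_
      rw [intervalIntegral.integral_const_mul,
        intervalIntegral_indicator_le (NNReal.coe_nonneg _) (hg1 σ t j)]
    symm
    rw [h1, Finset.sum_comm]
    refine Finset.sum_congr rfl fun σ _ => ?_
    rw [Finset.sum_comm]
    refine Finset.sum_congr rfl fun t _ => ?_
    rw [P.revenue_eq, Finset.mul_sum]
  have hbound : ∀ u ∈ Set.Ioo (0 : ℝ) 1,
      Ψ u ≤ 2 ^ m * (m * (22 * δ)) * u ^ (-(3 / 4) : ℝ) := by
    intro u hu
    set U : ℝ≥0 := u.toNNReal with hU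
    have hU0 : 0 < U := Real.toNNReal_pos.2 hu.1
    have hUu : (U : ℝ) = u := Real.coe_toNNReal _ hu.1.le
    -- With this root the level bound becomes a multiple of y⁻³ = u^(-3/4), whose integral over (0,
    -- 1) is 4; thus 88 = 4 · 22.
    set y : ℝ := u ^ (1 / 4 : ℝ) with hy
    have hy0 : 0 < y := Real.rpow_pos_of_pos hu.1 _
    have hy1 : y ≤ 1 := Real.rpow_le_one hu.1.le hu.2.le (by norm_num)
    have hy4 : y ^ 4 = u := by
      rw [hy, ← Real.rpow_natCast, ← Real.rpow_mul hu.1.le]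
      norm_num
    have hy3 : u ^ (-(3 / 4) : ℝ) = 1 / y ^ 3 := by
      rw [hy, ← Real.rpow_natCast, ← Real.rpow_mul hu.1.le, Real.rpow_neg hu.1.le, one_div]
      norm_num
    set x : Fin P.K → ℝ := fun j => (Finset.univ.filter fun t => U ≤ w t j).card with hx
    -- Markov's inequality, summed over the goods: the top bids add up to at most 1 per sample
    -- point.
    have hX : y ^ 4 * ∑ j, x j ≤ m := by
      rw [hy4, Finset.mul_sum]
      calc ∑ j, u * x j ≤ ∑ j, ∑ t, (w t j : ℝ) := by
            refine Finset.sum_le_sum fun j _ => ?_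
            simp only [hx]
            rw [mul_comm, ← nsmul_eq_mul]
            refine (Finset.card_nsmul_le_sum _ (fun t => (w t j : ℝ)) u fun t ht => ?_).trans
              (Finset.sum_le_sum_of_subset_of_nonneg (Finset.filter_subset _ _)
                fun _ _ _ => NNReal.coe_nonneg _)
            rw [← hUu]
            exact_mod_cast (Finset.mem_filter.1 ht).2
        _ = ∑ t, ∑ j, (w t j : ℝ) := Finset.sum_comm
        _ ≤ ∑ _t : Fin m, (1 : ℝ) := Finset.sum_le_sum fun t _ => hwsum t
        _ = m := by simp
    have hp1 : δ ^ 2 * y ^ 4 ≤ 1 := by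
      calc δ ^ 2 * y ^ 4 ≤ 1 * 1 := mul_le_mul (pow_le_one₀ hδ.le hδ1)
            (pow_le_one₀ hy0.le hy1) (by positivity) zero_le_one
        _ = 1 := one_mul 1
    have h1 : Ψ u ≤ ∑ j, 2 ^ m * ((2 * n * Real.log (1 / (δ ^ 2 * y ^ 4)) +
        δ ^ 2 * y ^ 4 * x j + (δ * y ^ 2) ^ 2 * x j / 2) / (δ * y ^ 2)) := by
      refine Finset.sum_le_sum fun j _ => ?_
      have h2 := sum_coinSign_levelSet_le (rule := rule) (fun t => P.bid j (z t)) hU0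
        (fun σ i => P.price (h σ) (P.slot i j)) (x := x j) rfl (p := δ ^ 2 * y ^ 4)
        (c := δ * y ^ 2) (by positivity) hp1 (by positivity)
      refine le_trans (le_of_eq ?_) h2
      refine Finset.sum_congr rfl fun σ _ => Finset.sum_congr rfl fun t _ => ?_
      congr 1
      refine if_congr ?_ rfl rfl
      rw [← NNReal.coe_le_coe, hUu]
    refine h1.trans ?_
    have h3 := level_tradeoff (X := ∑ j, x j) (M := m) (c := n * P.K) hy0 hy1 hδ hlog hX
      (by positivity) hm
    rw [hy3, mul_one_div, mul_div_assoc, ← Finset.mul_sum]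
    refine mul_le_mul_of_nonneg_left (le_trans (le_of_eq ?_) h3) (by positivity)
    rw [← Finset.sum_div]
    congr 1
    simp only [Finset.sum_add_distrib, ← Finset.sum_div, ← Finset.mul_sum, Finset.sum_const,
      Finset.card_univ, Fintype.card_fin, nsmul_eq_mul]
    ring
  rw [hΨeq]
  calc ∫ u in (0 : ℝ)..1, Ψ u
      ≤ ∫ u in (0 : ℝ)..1, 2 ^ m * (m * (22 * δ)) * u ^ (-(3 / 4) : ℝ) :=
        intervalIntegral.integral_mono_on_of_le_Ioo zero_le_one hΨint
          ((intervalIntegral.intervalIntegrable_rpow' (by norm_num)).const_mul _) hbound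
    _ = 2 ^ m * (m * (88 * δ)) := by
        rw [intervalIntegral.integral_const_mul, integral_rpow (Or.inl (by norm_num))]
        norm_num
        ring

/-- Replace a hypothesis by its part in `A` and its part in `B`, with a null auction in the class
that it does not belong to; the revenues add up. -/
theorem AuctionClass.RademacherLE.bestOf {A B : AuctionClass n k} {α β : ℝ}
    (hA : A.RademacherLE m α) (hB : B.RademacherLE m β)
    (hA0 : ∃ h, ∀ v, A.Good v → (A.mech h).revenue v = 0)
    (hB0 : ∃ h, ∀ v, B.Good v → (B.mech h).revenue v = 0) :
    (bestOf A B).RademacherLE m (α + β) := by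
  obtain ⟨a, ha⟩ := hA0
  obtain ⟨b, hb⟩ := hB0
  intro z hz h
  have hzA : ∀ t, A.Good (z t) := fun t g => hz t (Sum.inl g)
  have hzB : ∀ t, B.Good (z t) := fun t g => hz t (Sum.inr g)
  have h1 := hA z hzA fun σ => (h σ).elim id fun _ => a
  have h2 := hB z hzB fun σ => (h σ).elim (fun _ => b) id
  calc ∑ σ : Fin m → Bool, ∑ t, coinSign (σ t) * ((SplitSample.bestOf A B).mech (h σ)).revenue (z t)
      = ∑ σ : Fin m → Bool, ∑ t, coinSign (σ t) *
          (A.mech ((h σ).elim id fun _ => a)).revenue (z t) +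
        ∑ σ : Fin m → Bool, ∑ t, coinSign (σ t) *
          (B.mech ((h σ).elim (fun _ => b) id)).revenue (z t) := by
        rw [← Finset.sum_add_distrib]
        refine Finset.sum_congr rfl fun σ _ => ?_
        rw [← Finset.sum_add_distrib]
        refine Finset.sum_congr rfl fun t _ => ?_
        rw [← mul_add]
        congr 1
        rcases h σ with g | g
        · change (A.mech g).revenue (z t) = (A.mech g).revenue (z t) + (B.mech b).revenue (z t)
          rw [hb _ (hzB t), add_zero]
        · change (B.mech g).revenue (z t) = (A.mech a).revenue (z t) + (B.mech g).revenue (z t)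
          rw [ha _ (hzA t), zero_add]
    _ ≤ 2 ^ m * (m * α) + 2 ^ m * (m * β) := add_le_add h1 h2
    _ = 2 ^ m * (m * (α + β)) := by ring

/-- The two halves of the double sample are bounded separately, the second after reversing all
coins. -/
theorem AuctionClass.IsTame.optRevenue_le_of_rademacherLE {A : AuctionClass n k} (hA : A.IsTame)
    {erm : Multiset (Profile n k) → A.Hyp} (herm : A.IsERM erm)
    {D : ProbabilityMeasure (Profile n k)} (hD : D ∈ A.unitRevenue) (hm : 0 < m) {β : ℝ}
    (hβ : A.RademacherLE m β) :
    ENNReal.ofReal (A.optRevenue D) ≤ A.learnedRevenue erm D m + ENNReal.ofReal (2 * β) := by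
  refine hA.optRevenue_le herm hD hm fun s s' hs hs' h _ => ?_
  have h1 := hβ s hs h
  have h2 := hβ s' hs' fun σ => h fun t => !σ t
  let e : (Fin m → Bool) ≃ (Fin m → Bool) :=
    ⟨fun σ t => !σ t, fun σ t => !σ t, fun σ => by simp, fun σ => by simp⟩
  have h3 : ∑ σ : Fin m → Bool, ∑ t, -coinSign (σ t) * (A.mech (h σ)).revenue (s' t) ≤
      2 ^ m * (m * β) := by
    rw [← e.sum_comp]
    refine le_trans (le_of_eq ?_) h2
    refine Finset.sum_congr rfl fun σ _ => Finset.sum_congr rfl fun t _ => ?_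
    congr 1
    change -coinSign (!σ t) = _
    cases σ t <;> simp [coinSign]
  calc _ = ∑ σ : Fin m → Bool, ∑ t, coinSign (σ t) * (A.mech (h σ)).revenue (s t) +
        ∑ σ : Fin m → Bool, ∑ t, -coinSign (σ t) * (A.mech (h σ)).revenue (s' t) := by
        rw [← Finset.sum_add_distrib]
        refine Finset.sum_congr rfl fun σ _ => ?_
        rw [← Finset.sum_add_distrib]
        exact Finset.sum_congr rfl fun t _ => by ring
    _ ≤ 2 ^ m * (m * (2 * β)) := by linarith

/-! ### Sample complexity -/

theorem AuctionClass.IsTame.complexityLE {A : AuctionClass n k} (hA : A.IsTame) {x : ℝ}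
    (hx : 1 ≤ x) (hrad : ∀ (m : ℕ) (δ : ℝ), 0 < δ → 1 / 2 ≤ Real.log (1 / δ) →
      x * Real.log (1 / δ) / δ ^ 2 ≤ m → A.RademacherLE m (176 * δ))
    {ε : ℝ} (hε : 0 < ε) (hε2 : ε ≤ 1 / 2) :
    A.ComplexityLE ε (2000000 * (x * Real.log (1 / ε) / ε ^ 2)) := by
  intro erm herm
  -- The loss is twice the Rademacher bound 176 δ, and 352 δ = ε.
  set δ := ε / 352 with hδ
  have hδ0 : 0 < δ := by positivity
  have hinv : 2 ≤ 1 / ε := by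
    rw [le_div_iff₀ hε]
    linarith
  have hlogε : 1 / 2 ≤ Real.log (1 / ε) := by
    have := Real.log_le_log two_pos hinv
    linarith [Real.log_two_gt_d9]
  have h352 : Real.log 352 ≤ 9 * Real.log (1 / ε) := by
    have h1 : Real.log 352 ≤ Real.log ((1 / ε) ^ 9) := Real.log_le_log (by norm_num) (by
      calc (352 : ℝ) ≤ 2 ^ 9 := by norm_num
        _ ≤ (1 / ε) ^ 9 := by gcongr)
    rwa [Real.log_pow] at h1
  have hlogδ : Real.log (1 / δ) = Real.log 352 + Real.log (1 / ε) := by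
    rw [← Real.log_mul (by norm_num) (by positivity), hδ]
    congr 1
    field_simp
  have hlog352 : 0 ≤ Real.log 352 := Real.log_nonneg (by norm_num)
  set X := x * Real.log (1 / ε) / ε ^ 2 with hX
  have hX1 : 1 ≤ X := by
    rw [hX, le_div_iff₀ (by positivity)]
    nlinarith
  -- The constant is 10 · 352², since log(1/δ) ≤ 10 log(1/ε).
  have hY : x * Real.log (1 / δ) / δ ^ 2 ≤ 1239040 * X := by
    rw [hlogδ, hX, hδ, div_pow, div_div_eq_mul_div, ← mul_div_assoc]
    refine div_le_div_of_nonneg_right ?_ (by positivity)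
    nlinarith
  -- The added 1 keeps the sample nonempty; it and the rounding are absorbed through `X ≥ 1`.
  set m₀ : ℕ := ⌈x * Real.log (1 / δ) / δ ^ 2⌉₊ + 1 with hm₀
  have hY0 : 0 ≤ x * Real.log (1 / δ) / δ ^ 2 := by
    have : 0 ≤ Real.log (1 / δ) := by linarith
    positivity
  have hle : A.sampleComplexity erm A.unitRevenue ε ≤ m₀ := by
    refine sInf_le ⟨m₀, rfl, fun m hm D hD => ?_⟩
    have hm1 : x * Real.log (1 / δ) / δ ^ 2 ≤ m := (Nat.le_ceil _).trans (by
      exact_mod_cast (Nat.le_succ _).trans hm)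
    have hr := hrad m δ hδ0 (by linarith) hm1
    have := hA.optRevenue_le_of_rademacherLE herm hD (by omega) hr
    rwa [show 2 * (176 * δ) = ε by rw [hδ]; ring] at this
  calc (A.sampleComplexity erm A.unitRevenue ε : ℝ≥0∞) ≤ ((m₀ : ℕ∞) : ℝ≥0∞) := by
        exact_mod_cast hle
    _ = ENNReal.ofReal m₀ := by simp
    _ ≤ ENNReal.ofReal (2000000 * X) := by
        refine ENNReal.ofReal_le_ofReal ?_
        have := (Nat.ceil_lt_add_one hY0).le
        rw [hm₀]
        push_cast
        linarith

theorem Presentation.complexityLE {A : AuctionClass n k} (P : Presentation rule A) {x : ℝ}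
    (hx : 1 ≤ x) (hP : (n * P.K : ℝ) ≤ x) {ε : ℝ} (hε : 0 < ε) (hε2 : ε ≤ 1 / 2) :
    A.ComplexityLE ε (2000000 * (x * Real.log (1 / ε) / ε ^ 2)) := by
  refine P.isTame.complexityLE hx (fun m δ hδ hlog hm => ?_) hε hε2
  have h1 := P.rademacherLE (m := m) hδ hlog (le_trans (by gcongr) hm)
  intro z hz h
  refine (h1 z hz h).trans ?_
  gcongr
  norm_num

theorem Presentation.complexityLE_bestOf {A B : AuctionClass n k} (P : Presentation rule A)
    (Q : Presentation rule B) {x : ℝ} (hx : 1 ≤ x) (hP : (n * P.K : ℝ) ≤ x)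
    (hQ : (n * Q.K : ℝ) ≤ x) {ε : ℝ} (hε : 0 < ε) (hε2 : ε ≤ 1 / 2) :
    (bestOf A B).ComplexityLE ε (2000000 * (x * Real.log (1 / ε) / ε ^ 2)) := by
  refine (P.isTame.bestOf Q.isTame).complexityLE hx (fun m δ hδ hlog hm => ?_) hε hε2
  have h1 := P.rademacherLE (m := m) hδ hlog (le_trans (by gcongr) hm)
  have h2 := Q.rademacherLE (m := m) hδ hlog (le_trans (by gcongr) hm)
  have := h1.bestOf h2 P.exists_null Q.exists_null
  rwa [show 88 * δ + 88 * δ = 176 * δ by ring] at this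

end

noncomputable section

/-! ### Selling one good by an arbitrary truthful mechanism -/

section OneGood

variable {x p : ℝ≥0 → ℝ}

theorem alloc_monotone (hic : ∀ v w : ℝ≥0, v * x w - p w ≤ v * x v - p v) : Monotone x := by
  intro v w hvw
  rcases hvw.eq_or_lt with rfl | h
  · exact le_rfl
  · have h1 := hic v w
    have h2 := hic w v
    have h3 : (v : ℝ) < w := by exact_mod_cast h
    nlinarith

theorem pay_monotone (hic : ∀ v w : ℝ≥0, v * x w - p w ≤ v * x v - p v) : Monotone p := by
  intro v w hvw
  have h1 := hic v w
  have h2 := mul_le_mul_of_nonneg_left (alloc_monotone hic hvw) v.coe_nonneg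
  linarith

/-- On a grid above `θ`, a truthful payment is at most a combination of posted prices. -/
theorem pay_le_grid (hic : ∀ v w : ℝ≥0, v * x w - p w ≤ v * x v - p v)
    (hir : ∀ v : ℝ≥0, 0 ≤ v * x v - p v) (θ h : ℝ≥0) (N : ℕ) (v : ℝ≥0) (hθ : θ ≤ v)
    (hv : v ≤ θ + N * h) :
    p v ≤ θ * x θ + ∑ l ∈ Finset.range N, if θ + l * h ≤ v then
      ((θ + l * h : ℝ≥0) + h : ℝ) * (x (θ + (l + 1 : ℕ) * h) - x (θ + l * h)) else 0 := by
  have hmono := alloc_monotone hic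
  have hgrid : ∀ l : ℕ, θ + l * h ≤ θ + (l + 1 : ℕ) * h := fun l => by
    gcongr
    omega
  induction N generalizing v with
  | zero =>
    obtain rfl : v = θ := le_antisymm (by simpa using hv) hθ
    simp only [Finset.range_zero, Finset.sum_empty, add_zero]
    linarith [hir v]
  | succ N ih =>
    rw [Finset.sum_range_succ, ← add_assoc]
    rcases le_or_gt v (θ + N * h) with hvN | hvN
    · refine (ih v hθ hvN).trans (le_add_of_nonneg_right ?_)
      split_ifs
      · exact mul_nonneg (by positivity) (sub_nonneg.2 (hmono (hgrid N)))
      · exact le_rfl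
    · have h1 := ih (θ + N * h) le_self_add le_rfl
      have h2 : ∑ l ∈ Finset.range N, (if θ + l * h ≤ θ + N * h then
          ((θ + l * h : ℝ≥0) + h : ℝ) * (x (θ + (l + 1 : ℕ) * h) - x (θ + l * h)) else 0) =
          ∑ l ∈ Finset.range N, if θ + l * h ≤ v then
          ((θ + l * h : ℝ≥0) + h : ℝ) * (x (θ + (l + 1 : ℕ) * h) - x (θ + l * h)) else 0 := by
        refine Finset.sum_congr rfl fun l hl => ?_
        have hl' : θ + l * h ≤ θ + N * h := by
          gcongr
          exact (Finset.mem_range.1 hl).le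
        rw [if_pos hl', if_pos (hl'.trans hvN.le)]
      rw [h2] at h1
      rw [if_pos hvN.le]
      have h3 := pay_monotone hic hv
      -- The upper grid point does not gain by reporting the lower one, so the payment increment is
      -- at most the upper value times the allocation increment.
      have h4 := hic (θ + (N + 1 : ℕ) * h) (θ + N * h)
      have h5 : ((θ + (N + 1 : ℕ) * h : ℝ≥0) : ℝ) = (θ + N * h : ℝ≥0) + h := by
        push_cast
        ring
      rw [h5] at h4
      linarith

/-- The grid bound is a mixture of posted prices with allocation increments as weights. The weights
telescope to at most 1, each price earns at most r, and the mesh costs h. -/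
theorem lintegral_pay_le_add {μ : Measure ℝ≥0} [IsProbabilityMeasure μ]
    (hic : ∀ v w : ℝ≥0, v * x w - p w ≤ v * x v - p v)
    (hir : ∀ v : ℝ≥0, 0 ≤ v * x v - p v) (hx0 : ∀ v, 0 ≤ x v) (hx1 : ∀ v, x v ≤ 1) {r : ℝ}
    (hr : ∀ y : ℝ≥0, y * μ.real (Set.Ici y) ≤ r) (hμ : ∀ᵐ v ∂μ, v ≤ 1) (θ : ℝ≥0) {h : ℝ≥0}
    (hh : 0 < h) :
    ∫⁻ v, (if θ ≤ v then ENNReal.ofReal (p v) else 0) ∂μ ≤ ENNReal.ofReal (r + h) := by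
  obtain ⟨N, hN⟩ := exists_nat_ge (1 / h)
  have hN1 : 1 ≤ N * h := by rwa [div_le_iff₀ hh] at hN
  set z : ℕ → ℝ≥0 := fun l => θ + l * h with hz
  have hzmono : ∀ l, z l ≤ z (l + 1) := fun l => by
    simp only [hz]
    gcongr
    omega
  set c : ℕ → ℝ := fun l => (z l + h : ℝ) * (x (z (l + 1)) - x (z l)) with hc
  have hc0 : ∀ l, 0 ≤ c l := fun l =>
    mul_nonneg (by positivity) (sub_nonneg.2 (alloc_monotone hic (hzmono l)))
  have hr0 : 0 ≤ r := by simpa using hr 0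
  have hθ0 : 0 ≤ (θ : ℝ) * x θ := mul_nonneg θ.coe_nonneg (hx0 θ)
  calc ∫⁻ v, (if θ ≤ v then ENNReal.ofReal (p v) else 0) ∂μ
      ≤ ∫⁻ v, ((Set.Ici θ).indicator (fun _ => ENNReal.ofReal (θ * x θ)) v +
          ∑ l ∈ Finset.range N, (Set.Ici (z l)).indicator (fun _ => ENNReal.ofReal (c l)) v) ∂μ := by
        refine lintegral_mono_ae (hμ.mono fun v hv => ?_)
        split_ifs with hθ
        · have h1 := pay_le_grid hic hir θ h N v hθ (hv.trans (hN1.trans le_add_self))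
          rw [Set.indicator_of_mem (show v ∈ Set.Ici θ from hθ)]
          refine (ENNReal.ofReal_le_ofReal h1).trans (ENNReal.ofReal_add_le.trans ?_)
          gcongr
          rw [ENNReal.ofReal_sum_of_nonneg]
          · refine Finset.sum_le_sum fun l _ => ?_
            split_ifs with hl
            · rw [Set.indicator_of_mem (show v ∈ Set.Ici (z l) from hl)]
            · simp
          · intro l _
            split_ifs
            · exact hc0 l
            · exact le_rfl
        · exact zero_le
    _ = ENNReal.ofReal (θ * x θ) * μ (Set.Ici θ) +
          ∑ l ∈ Finset.range N, ENNReal.ofReal (c l) * μ (Set.Ici (z l)) := by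
        rw [lintegral_add_left (measurable_const.indicator measurableSet_Ici),
          lintegral_indicator_const measurableSet_Ici,
          lintegral_finsetSum _ fun l _ => measurable_const.indicator measurableSet_Ici]
        simp only [lintegral_indicator_const measurableSet_Ici]
    _ = ENNReal.ofReal (θ * x θ * μ.real (Set.Ici θ) +
          ∑ l ∈ Finset.range N, c l * μ.real (Set.Ici (z l))) := by
        rw [ENNReal.ofReal_add (by positivity)
          (Finset.sum_nonneg fun l _ => mul_nonneg (hc0 l) measureReal_nonneg),
          ENNReal.ofReal_sum_of_nonneg fun l _ => mul_nonneg (hc0 l) measureReal_nonneg,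
          ENNReal.ofReal_mul hθ0, ofReal_measureReal]
        congr 1
        refine Finset.sum_congr rfl fun l _ => ?_
        rw [ENNReal.ofReal_mul (hc0 l), ofReal_measureReal]
    _ ≤ ENNReal.ofReal (r + h) := by
        refine ENNReal.ofReal_le_ofReal ?_
        have h1 : θ * x θ * μ.real (Set.Ici θ) ≤ x θ * (r + h) := by
          have := mul_le_mul_of_nonneg_left (hr θ) (hx0 θ)
          nlinarith [mul_nonneg (hx0 θ) h.coe_nonneg]
        have h2 : ∀ l ∈ Finset.range N, c l * μ.real (Set.Ici (z l)) ≤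
            (x (z (l + 1)) - x (z l)) * (r + h) := fun l _ => by
          have h3 : (z l + h : ℝ) * μ.real (Set.Ici (z l)) ≤ r + h := by
            have := mul_le_of_le_one_right h.coe_nonneg
              (measureReal_le_one (μ := μ) (s := Set.Ici (z l)))
            linarith [hr (z l)]
          have := mul_le_mul_of_nonneg_left h3
            (sub_nonneg.2 (alloc_monotone hic (hzmono l)))
          simp only [hc]
          linarith
        have h4 := Finset.sum_le_sum h2
        rw [← Finset.sum_mul, Finset.sum_range_sub (fun l => x (z l))] at h4
        have h5 : z 0 = θ := by simp [hz]
        rw [h5] at h4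
        have h6 : x (z N) * (r + h) ≤ r + h := mul_le_of_le_one_left (by positivity) (hx1 _)
        linarith

/-- A truthful mechanism for one good earns no more than the best posted price on the
buyers above a threshold. -/
theorem lintegral_pay_le {μ : Measure ℝ≥0} [IsProbabilityMeasure μ]
    (hic : ∀ v w : ℝ≥0, v * x w - p w ≤ v * x v - p v)
    (hir : ∀ v : ℝ≥0, 0 ≤ v * x v - p v) (hx0 : ∀ v, 0 ≤ x v) (hx1 : ∀ v, x v ≤ 1) {r : ℝ}
    (hr : ∀ y : ℝ≥0, y * μ.real (Set.Ici y) ≤ r) (hμ : ∀ᵐ v ∂μ, v ≤ 1) (θ : ℝ≥0) :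
    ∫⁻ v, (if θ ≤ v then ENNReal.ofReal (p v) else 0) ∂μ ≤ ENNReal.ofReal r := by
  refine ENNReal.le_of_forall_pos_le_add fun h hh _ => ?_
  refine (lintegral_pay_le_add hic hir hx0 hx1 hr hμ θ hh).trans (ENNReal.ofReal_add_le.trans ?_)
  rw [ENNReal.ofReal_coe_nnreal]

end OneGood

/-! ### Truncated values -/

/-- The second moment of a value truncated at `R`, in terms of posted-price revenue. -/
theorem integral_truncation_sq_le {μ : Measure ℝ≥0} [IsProbabilityMeasure μ] {r R : ℝ}
    (hr : ∀ y : ℝ≥0, y * μ.real (Set.Ici y) ≤ r) (hR : 0 ≤ R) :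
    ∫ v, (if (v : ℝ) < R then (v : ℝ) else 0) ^ 2 ∂μ ≤ 2 * R * r := by
  have hr0 : 0 ≤ r := by simpa using hr 0
  set f : ℝ≥0 → ℝ := fun v => if (v : ℝ) < R then (v : ℝ) else 0 with hf
  have hf0 : ∀ v, 0 ≤ f v := fun v => by
    simp only [hf]
    split_ifs
    exacts [v.coe_nonneg, le_rfl]
  have hfm : Measurable f :=
    Measurable.ite (measurableSet_lt measurable_coe_nnreal_real measurable_const)
      measurable_coe_nnreal_real measurable_const
  -- Layer cake: the second moment is twice the integral of t · P(f ≥ t), which is at most r for t <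
  -- R and 0 beyond.
  have h1 := lintegral_rpow_eq_lintegral_meas_le_mul μ (Filter.Eventually.of_forall hf0)
    hfm.aemeasurable (p := 2) two_pos
  have h2 : ∫⁻ t in Set.Ioi (0 : ℝ), μ {a | t ≤ f a} * ENNReal.ofReal (t ^ (2 - 1 : ℝ)) ≤
      ENNReal.ofReal (R * r) := by
    calc ∫⁻ t in Set.Ioi (0 : ℝ), μ {a | t ≤ f a} * ENNReal.ofReal (t ^ (2 - 1 : ℝ))
        ≤ ∫⁻ t in Set.Ioi (0 : ℝ), (Set.Iio R).indicator (fun _ => ENNReal.ofReal r) t := by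
          refine setLIntegral_mono (measurable_const.indicator measurableSet_Iio) fun t ht => ?_
          have ht0 : (0 : ℝ) < t := ht
          rcases lt_or_ge t R with htR | htR
          · rw [Set.indicator_of_mem (show t ∈ Set.Iio R from htR)]
            have hsub : {a | t ≤ f a} ⊆ Set.Ici t.toNNReal := fun a ha => by
              have ha' : t ≤ f a := ha
              rw [Set.mem_Ici, Real.toNNReal_le_iff_le_coe]
              simp only [hf] at ha'
              split_ifs at ha'
              · exact ha'
              · linarith
            calc μ {a | t ≤ f a} * ENNReal.ofReal (t ^ (2 - 1 : ℝ))
                ≤ μ (Set.Ici t.toNNReal) * ENNReal.ofReal t := by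
                  norm_num
                  gcongr
              _ = ENNReal.ofReal (t.toNNReal * μ.real (Set.Ici t.toNNReal)) := by
                  rw [ENNReal.ofReal_mul (NNReal.coe_nonneg _), ofReal_measureReal,
                    Real.coe_toNNReal t ht0.le, mul_comm]
              _ ≤ ENNReal.ofReal r := ENNReal.ofReal_le_ofReal (hr _)
          · have : {a | t ≤ f a} = ∅ := by
              ext a
              simp only [Set.mem_ofPred_eq, Set.mem_empty_iff_false, iff_false, not_le, hf]
              split_ifs <;> linarith
            rw [this, measure_empty, zero_mul]
            exact zero_le
      _ = ENNReal.ofReal r * ENNReal.ofReal R := by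
          rw [lintegral_indicator_const measurableSet_Iio, Measure.restrict_apply measurableSet_Iio,
            Set.inter_comm, Set.Ioi_inter_Iio, Real.volume_Ioo, sub_zero]
      _ = ENNReal.ofReal (R * r) := by rw [mul_comm, ENNReal.ofReal_mul hR]
  rw [integral_eq_lintegral_of_nonneg_ae (Filter.Eventually.of_forall fun v => sq_nonneg _)
    (hfm.pow_const 2).aestronglyMeasurable]
  refine ENNReal.toReal_le_of_le_ofReal (by positivity) ?_
  have h3 : ∀ v, f v ^ (2 : ℝ) = f v ^ 2 := fun v => by
    rw [← Real.rpow_natCast]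
    norm_num
  simp only [h3] at h1
  rw [h1]
  calc ENNReal.ofReal 2 * _ ≤ ENNReal.ofReal 2 * ENNReal.ofReal (R * r) := by gcongr
    _ = ENNReal.ofReal (2 * R * r) := by rw [← ENNReal.ofReal_mul two_pos.le, mul_assoc]

end

noncomputable section

/-! ### Revenue from one additive bidder with independent values -/

section OneBidder

variable {k : ℕ} {μ : Fin k → Measure ℝ≥0} [∀ j, IsProbabilityMeasure (μ j)]

/-- Fubini: it suffices to integrate out coordinate j with all others fixed. Independence of the
items enters here. -/
theorem lintegral_pi_le_of_update {f g : (Fin k → ℝ≥0) → ℝ≥0∞} (hf : Measurable f)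
    (hg : Measurable g) (j : Fin k) (hgj : ∀ v t, g (Function.update v j t) = g v)
    (h : ∀ v, ∫⁻ t, f (Function.update v j t) ∂μ j ≤ g v) :
    ∫⁻ v, f v ∂Measure.pi μ ≤ ∫⁻ v, g v ∂Measure.pi μ := by
  refine lintegral_le_of_lmarginal_le {j} hf hg ?_
  rw [lmarginal_singleton, lmarginal_singleton]
  intro v
  simpa [hgj] using h v

/-- The value of item `l`, if another item has at least the same value. -/
def outshone (v : Fin k → ℝ≥0) (l : Fin k) : ℝ≥0∞ :=
  open Classical in if ∃ j ≠ l, v l ≤ v j then (v l : ℝ≥0∞) else 0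

/-- What is left of the payment after the values received from items other than `j`. -/
def marginalPay (x : (Fin k → ℝ≥0) → Fin k → ℝ) (p : (Fin k → ℝ≥0) → ℝ) (j : Fin k)
    (v : Fin k → ℝ≥0) : ℝ :=
  p v - ∑ l ∈ Finset.univ.erase j, v l * x v l

variable {x : (Fin k → ℝ≥0) → Fin k → ℝ} {p : (Fin k → ℝ≥0) → ℝ}

/-- Split off a favorite item j. The rest of the payment is at most the total value of the other
items, each of which is outshone by j. -/
theorem ofReal_pay_le (hk : 0 < k) (hx1 : ∀ v l, x v l ≤ 1) (v : Fin k → ℝ≥0) :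
    ENNReal.ofReal (p v) ≤
      ∑ j, (if Finset.univ.sup v ≤ v j then ENNReal.ofReal (marginalPay x p j v) else 0) +
        ∑ l, outshone v l := by
  classical
  obtain ⟨j, -, hj⟩ := Finset.exists_mem_eq_sup Finset.univ ⟨⟨0, hk⟩, Finset.mem_univ _⟩ v
  have hmax : ∀ l, v l ≤ v j := fun l => hj ▸ Finset.le_sup (f := v) (Finset.mem_univ l)
  have h1 : p v = marginalPay x p j v + ∑ l ∈ Finset.univ.erase j, v l * x v l := by
    simp [marginalPay]
  rw [h1]
  refine ENNReal.ofReal_add_le.trans (add_le_add ?_ ?_)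
  · refine le_trans ?_ (Finset.single_le_sum (f := fun j => if Finset.univ.sup v ≤ v j then
      ENNReal.ofReal (marginalPay x p j v) else 0) (fun _ _ => zero_le) (Finset.mem_univ j))
    simp only [if_pos hj.le, le_refl]
  · calc ENNReal.ofReal (∑ l ∈ Finset.univ.erase j, v l * x v l)
        ≤ ENNReal.ofReal (∑ l ∈ Finset.univ.erase j, (v l : ℝ)) :=
          ENNReal.ofReal_le_ofReal (Finset.sum_le_sum fun l _ =>
            mul_le_of_le_one_right (v l).coe_nonneg (hx1 v l))
      _ = ∑ l ∈ Finset.univ.erase j, (v l : ℝ≥0∞) := by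
          rw [ENNReal.ofReal_sum_of_nonneg fun l _ => (v l).coe_nonneg]
          simp only [ENNReal.ofReal_coe_nnreal]
      _ ≤ ∑ l ∈ Finset.univ.erase j, outshone v l := by
          refine Finset.sum_le_sum fun l hl => ?_
          rw [outshone, if_pos ⟨j, (Finset.ne_of_mem_erase hl).symm, hmax l⟩]
      _ ≤ ∑ l, outshone v l := Finset.sum_le_sum_of_subset (Finset.erase_subset _ _)

theorem measurable_sup_pi : Measurable fun v : Fin k → ℝ≥0 => Finset.univ.sup v := by
  generalize (Finset.univ : Finset (Fin k)) = s
  induction s using Finset.induction_on with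
  | empty => simp
  | insert j s _ ih => simpa only [Finset.sup_insert] using (measurable_pi_apply j).max ih

/-- The favorite item contributes at most its best posted-price revenue. -/
theorem lintegral_marginalPay_le (hx0 : ∀ v l, 0 ≤ x v l) (hx1 : ∀ v l, x v l ≤ 1)
    (hic : ∀ v w : Fin k → ℝ≥0, ∑ l, v l * x w l - p w ≤ ∑ l, v l * x v l - p v)
    (hir : ∀ v : Fin k → ℝ≥0, 0 ≤ ∑ l, v l * x v l - p v)
    (hxm : Measurable x) (hpm : Measurable p) (j : Fin k) {r : ℝ}
    (hr : ∀ y : ℝ≥0, y * (μ j).real (Set.Ici y) ≤ r) (hμ : ∀ᵐ v ∂μ j, v ≤ 1) :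
    ∫⁻ v : Fin k → ℝ≥0,
      (if Finset.univ.sup v ≤ v j then ENNReal.ofReal (marginalPay x p j v) else 0)
      ∂Measure.pi μ ≤ ENNReal.ofReal r := by
  classical
  have hmm : Measurable (marginalPay x p j) := by
    unfold marginalPay
    fun_prop
  refine (lintegral_pi_le_of_update (g := fun _ => ENNReal.ofReal r)
    (Measurable.ite (measurableSet_le measurable_sup_pi (measurable_pi_apply j))
      hmm.ennreal_ofReal measurable_const) measurable_const j (fun _ _ => rfl)
    fun v => ?_).trans (by simp)
  have hsplit : ∀ (t : ℝ≥0) (y : Fin k → ℝ),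
      ∑ l, (Function.update v j t l : ℝ) * y l =
        t * y j + ∑ l ∈ Finset.univ.erase j, (v l : ℝ) * y l := fun t y => by
    rw [← Finset.add_sum_erase _ _ (Finset.mem_univ j), Function.update_self]
    congr 1
    refine Finset.sum_congr rfl fun l hl => ?_
    rw [Function.update_of_ne (Finset.ne_of_mem_erase hl)]
  have hmp : ∀ t : ℝ≥0, marginalPay x p j (Function.update v j t) = p (Function.update v j t) -
      ∑ l ∈ Finset.univ.erase j, (v l : ℝ) * x (Function.update v j t) l := fun t => by
    unfold marginalPay
    congr 1
    refine Finset.sum_congr rfl fun l hl => ?_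
    rw [Function.update_of_ne (Finset.ne_of_mem_erase hl)]
  have hsup : ∀ t : ℝ≥0, Finset.univ.sup (Function.update v j t) ≤ t ↔
      (Finset.univ.erase j).sup v ≤ t := fun t => by
    simp only [Finset.sup_le_iff, Finset.mem_univ, true_implies, Finset.mem_erase, and_true]
    refine ⟨fun H l hl => by simpa [Function.update_of_ne hl] using H l, fun H l => ?_⟩
    by_cases hl : l = j
    · subst hl
      simp
    · rw [Function.update_of_ne hl]
      exact H l hl
  -- With the other values fixed, counting the value received from those items as a rebate turns the
  -- mechanism into a truthful one for item j alone. The threshold is the highest other value.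
  have h1 := lintegral_pay_le (μ := μ j) (x := fun t => x (Function.update v j t) j)
    (p := fun t => marginalPay x p j (Function.update v j t)) (r := r)
    (fun t s => by
      have := hic (Function.update v j t) (Function.update v j s)
      rw [hsplit, hsplit] at this
      rw [hmp, hmp]
      linarith)
    (fun t => by
      have := hir (Function.update v j t)
      rw [hsplit] at this
      rw [hmp]
      linarith)
    (fun t => hx0 _ _) (fun t => hx1 _ _) hr hμ ((Finset.univ.erase j).sup v)
  simpa only [Function.update_self, hsup] using h1

/-- The contribution of items that are valued at least `R`, yet no more than another item. -/
theorem lintegral_outshone_le {r : Fin k → ℝ}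
    (hr : ∀ j (y : ℝ≥0), y * (μ j).real (Set.Ici y) ≤ r j) {R : ℝ≥0} (hR : (R : ℝ) = ∑ j, r j) :
    ∫⁻ v, ∑ l, outshone v l ∂Measure.pi μ ≤ ENNReal.ofReal (∑ l, r l) +
      ∫⁻ v, ∑ l, (if v l < R then (v l : ℝ≥0∞) else 0) ∂Measure.pi μ := by
  classical
  have hr0 : ∀ j, 0 ≤ r j := fun j => by simpa using hr j 0
  set tail : Fin k → Fin k → (Fin k → ℝ≥0) → ℝ≥0∞ := fun l j v =>
    if R ≤ v l ∧ v l ≤ v j then (v l : ℝ≥0∞) else 0 with htail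
  have hval : ∀ l, Measurable fun v : Fin k → ℝ≥0 => (v l : ℝ≥0∞) := fun l =>
    measurable_coe_nnreal_ennreal.comp (measurable_pi_apply l)
  have htm : ∀ l j, Measurable (tail l j) := fun l j => by
    have h1 : MeasurableSet {v : Fin k → ℝ≥0 | R ≤ v l} :=
      measurableSet_le measurable_const (measurable_pi_apply l)
    have h2 : MeasurableSet {v : Fin k → ℝ≥0 | v l ≤ v j} :=
      measurableSet_le (measurable_pi_apply l) (measurable_pi_apply j)
    exact Measurable.ite (h1.inter h2) (hval l) measurable_const
  have hpoint : ∀ v : Fin k → ℝ≥0, ∑ l, outshone v l ≤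
      ∑ l, ∑ j ∈ Finset.univ.erase l, tail l j v +
        ∑ l, (if v l < R then (v l : ℝ≥0∞) else 0) := fun v => by
    rw [← Finset.sum_add_distrib]
    refine Finset.sum_le_sum fun l _ => ?_
    unfold outshone
    split_ifs with h1 h2 h2
    · exact le_add_self
    · obtain ⟨j, hj, hlj⟩ := h1
      refine le_add_right (le_trans ?_ (Finset.single_le_sum (f := fun j => tail l j v)
        (fun _ _ => zero_le) (Finset.mem_erase.2 ⟨hj, Finset.mem_univ j⟩)))
      simp only [htail, if_pos (And.intro (not_lt.1 h2) hlj), le_refl]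
    · exact zero_le
    · exact zero_le
  -- Given v l, the expectation over item j is the revenue from posting v l as its price, at most r
  -- j.
  have htail_le : ∀ l, ∀ j ∈ Finset.univ.erase l, ∫⁻ v, tail l j v ∂Measure.pi μ ≤
      ENNReal.ofReal (r j) * μ l (Set.Ici R) := fun l j hj => by
    have hlj : l ≠ j := (Finset.ne_of_mem_erase hj).symm
    have hset : MeasurableSet {v : Fin k → ℝ≥0 | R ≤ v l} :=
      measurableSet_le measurable_const (measurable_pi_apply l)
    have h1 := lintegral_pi_le_of_update (μ := μ)
      (g := {v : Fin k → ℝ≥0 | R ≤ v l}.indicator fun _ => ENNReal.ofReal (r j)) (htm l j)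
      (measurable_const.indicator hset) j
      (fun v t => by simp [Set.indicator_apply, Function.update_of_ne hlj]) fun v => by
        simp only [htail, Function.update_of_ne hlj, Function.update_self]
        by_cases hv : R ≤ v l
        · rw [Set.indicator_of_mem (show v ∈ {v : Fin k → ℝ≥0 | R ≤ v l} from hv)]
          have h2 : ∀ t, (if R ≤ v l ∧ v l ≤ t then (v l : ℝ≥0∞) else 0) =
              (Set.Ici (v l)).indicator (fun _ => (v l : ℝ≥0∞)) t := fun t => by
            simp [Set.indicator_apply, hv]
          simp only [h2]
          rw [lintegral_indicator_const measurableSet_Ici]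
          calc (v l : ℝ≥0∞) * μ j (Set.Ici (v l))
              = ENNReal.ofReal (v l * (μ j).real (Set.Ici (v l))) := by
                rw [ENNReal.ofReal_mul (v l).coe_nonneg, ofReal_measureReal,
                  ENNReal.ofReal_coe_nnreal]
            _ ≤ _ := ENNReal.ofReal_le_ofReal (hr j _)
        · simp [hv]
    refine h1.trans (le_of_eq ?_)
    rw [lintegral_indicator_const hset]
    congr 1
    rw [← (measurePreserving_eval μ l).measure_preimage measurableSet_Ici.nullMeasurableSet]
    rfl
  calc ∫⁻ v, ∑ l, outshone v l ∂Measure.pi μ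
      ≤ ∫⁻ v, (∑ l, ∑ j ∈ Finset.univ.erase l, tail l j v +
        ∑ l, (if v l < R then (v l : ℝ≥0∞) else 0)) ∂Measure.pi μ := lintegral_mono hpoint
    _ = ∑ l, ∑ j ∈ Finset.univ.erase l, ∫⁻ v, tail l j v ∂Measure.pi μ +
        ∫⁻ v, ∑ l, (if v l < R then (v l : ℝ≥0∞) else 0) ∂Measure.pi μ := by
        rw [lintegral_add_left (Finset.measurable_fun_sum _ fun l _ =>
          Finset.measurable_fun_sum _ fun j _ => htm l j),
          lintegral_finsetSum _ fun l _ => Finset.measurable_fun_sum _ fun j _ => htm l j]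
        congr 1
        exact Finset.sum_congr rfl fun l _ => lintegral_finsetSum _ fun j _ => htm l j
    _ ≤ _ := by
        gcongr
        rw [ENNReal.ofReal_sum_of_nonneg fun l _ => hr0 l]
        refine Finset.sum_le_sum fun l _ => ?_
        -- Summing r j over j gives R, and R · P(v l ≥ R) is again a posted-price revenue, now of
        -- item l.
        calc ∑ j ∈ Finset.univ.erase l, ∫⁻ v, tail l j v ∂Measure.pi μ
            ≤ ∑ j ∈ Finset.univ.erase l, ENNReal.ofReal (r j) * μ l (Set.Ici R) :=
              Finset.sum_le_sum (htail_le l)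
          _ ≤ ∑ j, ENNReal.ofReal (r j) * μ l (Set.Ici R) :=
              Finset.sum_le_sum_of_subset (Finset.erase_subset _ _)
          _ = ENNReal.ofReal (R * (μ l).real (Set.Ici R)) := by
              rw [← Finset.sum_mul, ← ENNReal.ofReal_sum_of_nonneg fun l _ => hr0 l, ← hR,
                ENNReal.ofReal_mul R.coe_nonneg, ofReal_measureReal]
          _ ≤ ENNReal.ofReal (r l) := ENNReal.ofReal_le_ofReal (hr l R)

/-- The truncated values concentrate, so that a price on the grand bundle extracts them. -/
theorem lintegral_core_le {r : Fin k → ℝ}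
    (hr : ∀ j (y : ℝ≥0), y * (μ j).real (Set.Ici y) ≤ r j) {R : ℝ≥0} (hR : (R : ℝ) = ∑ j, r j)
    {B : ℝ} (hB : ∀ y : ℝ≥0, y * (Measure.pi μ).real {v | y ≤ ∑ l, v l} ≤ B) :
    ∫⁻ v, ∑ l, (if v l < R then (v l : ℝ≥0∞) else 0) ∂Measure.pi μ ≤
      ENNReal.ofReal (2 * B + 2 * ∑ l, r l) := by
  classical
  have hB0 : 0 ≤ B := by simpa using hB 0
  set f : ℝ≥0 → ℝ := fun v => if (v : ℝ) < R then (v : ℝ) else 0 with hf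
  have hf0 : ∀ v, 0 ≤ f v := fun v => by
    simp only [hf]
    split_ifs
    exacts [v.coe_nonneg, le_rfl]
  have hfR : ∀ v, f v ≤ R := fun v => by
    simp only [hf]
    split_ifs with h
    exacts [h.le, R.coe_nonneg]
  have hfv : ∀ v, f v ≤ v := fun v => by
    simp only [hf]
    split_ifs
    exacts [le_rfl, v.coe_nonneg]
  have hfm : Measurable f :=
    Measurable.ite (measurableSet_lt measurable_coe_nnreal_real measurable_const)
      measurable_coe_nnreal_real measurable_const
  have hLp : ∀ j, MemLp f 2 (μ j) := fun j =>
    MemLp.of_bound hfm.aestronglyMeasurable R (Filter.Eventually.of_forall fun v => by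
      rw [Real.norm_of_nonneg (hf0 v)]
      exact hfR v)
  set X : (Fin k → ℝ≥0) → ℝ := ∑ l, fun v => f (v l) with hX
  have hXv : ∀ v, X v = ∑ l, f (v l) := fun v => by simp [hX]
  have hX0 : ∀ v, 0 ≤ X v := fun v => by
    rw [hXv]
    exact Finset.sum_nonneg fun l _ => hf0 _
  have hXm : Measurable X := by
    have : X = fun v => ∑ l, f (v l) := funext hXv
    rw [this]
    exact Finset.measurable_fun_sum _ fun l _ => hfm.comp (measurable_pi_apply l)
  have hXR : ∀ v, X v ≤ k * R := fun v => by
    rw [hXv]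
    calc ∑ l, f (v l) ≤ ∑ _l : Fin k, (R : ℝ) := Finset.sum_le_sum fun l _ => hfR _
      _ = k * R := by simp
  have hXLp : MemLp X 2 (Measure.pi μ) :=
    MemLp.of_bound hXm.aestronglyMeasurable (k * R) (Filter.Eventually.of_forall fun v => by
      rw [Real.norm_of_nonneg (hX0 v)]
      exact hXR v)
  have hXi : Integrable X (Measure.pi μ) := hXLp.integrable one_le_two
  have hvar : Var[X; Measure.pi μ] ≤ 2 * (R : ℝ) ^ 2 := by
    rw [hX, variance_sum_pi hLp]
    calc ∑ l, Var[f; μ l] ≤ ∑ l, 2 * R * r l := Finset.sum_le_sum fun l _ =>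
          (variance_le_expectation_sq hfm.aestronglyMeasurable).trans
            (integral_truncation_sq_le (hr l) R.coe_nonneg)
      _ = 2 * (R : ℝ) ^ 2 := by
          rw [← Finset.mul_sum, ← hR]
          ring
  have heq : ∫⁻ v, ∑ l, (if v l < R then (v l : ℝ≥0∞) else 0) ∂Measure.pi μ =
      ENNReal.ofReal (∫ v, X v ∂Measure.pi μ) := by
    rw [ofReal_integral_eq_lintegral_ofReal hXi (Filter.Eventually.of_forall hX0)]
    refine lintegral_congr fun v => ?_
    rw [hXv, ENNReal.ofReal_sum_of_nonneg fun l _ => hf0 _]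
    refine Finset.sum_congr rfl fun l _ => ?_
    simp only [hf, NNReal.coe_lt_coe]
    split_ifs <;> simp
  rw [heq, ← hR]
  refine ENNReal.ofReal_le_ofReal ?_
  set c := ∫ v, X v ∂Measure.pi μ with hc
  -- Chebyshev's inequality below divides by R; for R = 0 the truncated values vanish.
  rcases eq_or_lt_of_le (zero_le (a := R)) with hR0 | hR0
  · have hcle : c ≤ k * R := by
      calc c ≤ ∫ _, (k * R : ℝ) ∂Measure.pi μ :=
            integral_mono hXi (integrable_const _) hXR
        _ = k * R := by simp
    rw [← hR0] at hcle ⊢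
    simp only [NNReal.coe_zero, mul_zero] at hcle ⊢
    linarith
  have hR0' : (0 : ℝ) < R := hR0
  by_contra! hlt
  -- The variance is at most 2R², so a deviation of 2R has probability at most 1/2, and the bundle
  -- price c - 2R sells at least half of the time.
  have hcheb := meas_ge_le_variance_div_sq (μ := Measure.pi μ) hXLp (c := 2 * R) (by positivity)
  have hcheb' : (Measure.pi μ).real {v | 2 * (R : ℝ) ≤ |X v - c|} ≤ 1 / 2 := by
    refine ENNReal.toReal_le_of_le_ofReal (by norm_num) (hcheb.trans
      (ENNReal.ofReal_le_ofReal ?_))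
    rw [div_le_iff₀ (by positivity)]
    nlinarith
  set y : ℝ≥0 := (c - 2 * R).toNNReal with hy
  have hyc : (y : ℝ) = c - 2 * R := Real.coe_toNNReal _ (by linarith)
  have hsub : {v | 2 * (R : ℝ) ≤ |X v - c|}ᶜ ⊆ {v : Fin k → ℝ≥0 | y ≤ ∑ l, v l} := fun v hv => by
    simp only [Set.mem_compl_iff, Set.mem_ofPred_eq, not_le] at hv ⊢
    have h1 := (abs_lt.1 hv).1
    have h2 : X v ≤ ∑ l, (v l : ℝ) := by
      rw [hXv]
      exact Finset.sum_le_sum fun l _ => hfv _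
    have h3 : (y : ℝ) ≤ ∑ l, (v l : ℝ) := by linarith
    exact_mod_cast h3
  have hhalf : 1 / 2 ≤ (Measure.pi μ).real {v : Fin k → ℝ≥0 | y ≤ ∑ l, v l} := by
    refine le_trans ?_ (measureReal_mono hsub)
    rw [probReal_compl_eq_one_sub (by
      simpa only [Real.norm_eq_abs] using
        measurableSet_le measurable_const (hXm.sub_const c).norm)]
    linarith
  have := hB y
  rw [hyc] at this
  have h4 : (c - 2 * R) * (1 / 2) ≤ B := le_trans (by
    refine mul_le_mul_of_nonneg_left hhalf ?_
    linarith) this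
  linarith

/-- A truthful mechanism for one additive bidder with independent values earns at most four times
the item-pricing revenue plus twice the bundle-pricing revenue. -/
theorem integral_pay_le (hk : 0 < k) (hx0 : ∀ v l, 0 ≤ x v l) (hx1 : ∀ v l, x v l ≤ 1)
    (hic : ∀ v w : Fin k → ℝ≥0, ∑ l, v l * x w l - p w ≤ ∑ l, v l * x v l - p v)
    (hir : ∀ v : Fin k → ℝ≥0, 0 ≤ ∑ l, v l * x v l - p v)
    (hxm : Measurable x) (hpm : Measurable p) {r : Fin k → ℝ}
    (hr : ∀ j (y : ℝ≥0), y * (μ j).real (Set.Ici y) ≤ r j) (hμ : ∀ j, ∀ᵐ v ∂μ j, v ≤ 1)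
    {B : ℝ} (hB : ∀ y : ℝ≥0, y * (Measure.pi μ).real {v | y ≤ ∑ l, v l} ≤ B) :
    ∫ v, p v ∂Measure.pi μ ≤ 4 * ∑ j, r j + 2 * B := by
  classical
  have hB0 : 0 ≤ B := by simpa using hB 0
  have hr0 : ∀ j, 0 ≤ r j := fun j => by simpa using hr j 0
  have hS0 : 0 ≤ ∑ j, r j := Finset.sum_nonneg fun j _ => hr0 j
  set R : ℝ≥0 := ⟨∑ j, r j, hS0⟩
  have hR : (R : ℝ) = ∑ j, r j := rfl
  have hlint : ∫⁻ v, ENNReal.ofReal (p v) ∂Measure.pi μ ≤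
      ENNReal.ofReal (4 * ∑ j, r j + 2 * B) := by
    have hmm : ∀ j, Measurable fun v : Fin k → ℝ≥0 => (if Finset.univ.sup v ≤ v j then
        ENNReal.ofReal (marginalPay x p j v) else 0) := fun j => by
      have : Measurable (marginalPay x p j) := by
        unfold marginalPay
        fun_prop
      exact Measurable.ite (measurableSet_le measurable_sup_pi (measurable_pi_apply j))
        this.ennreal_ofReal measurable_const
    calc ∫⁻ v, ENNReal.ofReal (p v) ∂Measure.pi μ
        ≤ ∫⁻ v, (∑ j, (if Finset.univ.sup v ≤ v j then
            ENNReal.ofReal (marginalPay x p j v) else 0) + ∑ l, outshone v l) ∂Measure.pi μ :=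
          lintegral_mono fun v => ofReal_pay_le hk hx1 v
      _ = ∑ j, ∫⁻ v, (if Finset.univ.sup v ≤ v j then
            ENNReal.ofReal (marginalPay x p j v) else 0) ∂Measure.pi μ +
            ∫⁻ v, ∑ l, outshone v l ∂Measure.pi μ := by
          rw [lintegral_add_left (Finset.measurable_fun_sum _ fun j _ => hmm j),
            lintegral_finsetSum _ fun j _ => hmm j]
      _ ≤ ∑ j, ENNReal.ofReal (r j) + (ENNReal.ofReal (∑ l, r l) +
            ENNReal.ofReal (2 * B + 2 * ∑ l, r l)) := by
          refine add_le_add (Finset.sum_le_sum fun j _ =>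
            lintegral_marginalPay_le hx0 hx1 hic hir hxm hpm j (hr j) (hμ j)) ?_
          refine (lintegral_outshone_le hr hR).trans ?_
          gcongr
          exact lintegral_core_le hr hR hB
      _ = ENNReal.ofReal (4 * ∑ j, r j + 2 * B) := by
          rw [← ENNReal.ofReal_sum_of_nonneg fun j _ => hr0 j, ← ENNReal.ofReal_add hS0 (by positivity),
            ← ENNReal.ofReal_add hS0 (by positivity)]
          congr 1
          ring
  by_cases hp : Integrable p (Measure.pi μ)
  · rw [integral_eq_lintegral_pos_part_sub_lintegral_neg_part hp]
    have h1 := ENNReal.toReal_le_of_le_ofReal (by positivity) hlint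
    linarith [ENNReal.toReal_nonneg (a := ∫⁻ v, ENNReal.ofReal (-p v) ∂Measure.pi μ)]
  -- A payment that is not integrable has Bochner integral 0.
  · rw [integral_undef hp]
    positivity

end OneBidder

end

noncomputable section

/-! ### Best-of-both pricing for one bidder -/

section Benchmark

variable {k : ℕ} {rule : SaleRule}

/-- With one bidder, the class contains all item prices and all grand-bundle prices. -/
structure AuctionClass.ContainsBest (A : AuctionClass 1 k) : Prop where
  item : ∀ q : Fin k → ℝ≥0, ∃ h, ∀ v, (A.mech h).revenue v =
    ∑ j, if q j ≤ v 0 j then (q j : ℝ) else 0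
  bundle : ∀ y : ℝ≥0, ∃ h, ∀ v, (A.mech h).revenue v = if y ≤ ∑ j, v 0 j then (y : ℝ) else 0

theorem containsBest_anonymousBest : (anonymousBestPricing rule 1 k).ContainsBest where
  item q := ⟨Sum.inr q, fun v => (itemMechanism_revenue rule (fun _ => q) v).trans (by
    simp [goodRevenue_one, apply_ite NNReal.toReal])⟩
  bundle y := ⟨Sum.inl y, fun v => (bundleMechanism_revenue rule (fun _ => y) v).trans (by
    simp [goodRevenue_one, apply_ite NNReal.toReal])⟩

theorem containsBest_best : (bestPricing rule 1 k).ContainsBest where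
  item q := ⟨Sum.inr fun _ => q, fun v => (itemMechanism_revenue rule (fun _ => q) v).trans (by
    simp [goodRevenue_one, apply_ite NNReal.toReal])⟩
  bundle y := ⟨Sum.inl fun _ => y, fun v => (bundleMechanism_revenue rule (fun _ => y) v).trans (by
    simp [goodRevenue_one, apply_ite NNReal.toReal])⟩

theorem integral_ite_price {Ω : Type*} [MeasurableSpace Ω] {D : Measure Ω} (y : ℝ≥0)
    {f : Ω → ℝ≥0} (hf : Measurable f) :
    ∫ v, (if y ≤ f v then (y : ℝ) else 0) ∂D = y * D.real {v | y ≤ f v} := by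
  have : (fun v => if y ≤ f v then (y : ℝ) else 0) =
      {v | y ≤ f v}.indicator fun _ => (y : ℝ) := by
    ext v
    simp [Set.indicator_apply]
  rw [this, integral_indicator_const _ (measurableSet_le measurable_const hf), smul_eq_mul, mul_comm]

/-- For one bidder with independent item values, the better of item pricing and grand-bundle
pricing is a six-approximation to all truthful mechanisms. -/
theorem AuctionClass.ContainsBest.expRevenue_le {A : AuctionClass 1 k} (hA : A.ContainsBest)
    (hk : 0 < k) {D : ProbabilityMeasure (Profile 1 k)} (hD : D ∈ A.unitRevenue)
    (hind : iIndepFun (fun (j : Fin k) (v : Profile 1 k) => v 0 j) (D : Measure (Profile 1 k)))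
    {M : Mechanism 1 k} (hM : M.IsTruthful) (halloc : Measurable M.alloc)
    (hpay : Measurable M.pay) : M.expRevenue D ≤ 6 * A.optRevenue D := by
  have hgood : ∀ᵐ v ∂(D : Measure (Profile 1 k)), A.Good v := hD
  have hbdd : BddAbove (Set.range fun h => (A.mech h).expRevenue (D : Measure (Profile 1 k))) :=
    ⟨1, by
      rintro _ ⟨h, rfl⟩
      exact (AuctionClass.expRevenue_mem_unit hgood h).2⟩
  have hle : ∀ h, (A.mech h).expRevenue (D : Measure (Profile 1 k)) ≤ A.optRevenue D :=
    fun h => le_ciSup hbdd h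
  have hm0 : Measurable fun v : Profile 1 k => v 0 := measurable_pi_apply 0
  have hmj : ∀ j, Measurable fun v : Profile 1 k => v 0 j := fun j =>
    (measurable_pi_apply j).comp hm0
  set μ : Fin k → Measure ℝ≥0 := fun j => (D : Measure (Profile 1 k)).map fun v => v 0 j with hμ
  have hprob : ∀ j, IsProbabilityMeasure (μ j) := fun j =>
    Measure.isProbabilityMeasure_map (hmj j).aemeasurable
  have hpi : (D : Measure (Profile 1 k)).map (fun v => v 0) = Measure.pi μ :=
    hind.map_fun_eq_pi_map fun j => (hmj j).aemeasurable
  set f : Fin k → ℝ≥0 → ℝ := fun j y => y * (μ j).real (Set.Ici y) with hf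
  have hf_eq : ∀ j y, f j y = ∫ v, (if y ≤ v 0 j then (y : ℝ) else 0)
      ∂(D : Measure (Profile 1 k)) := fun j y => by
    rw [integral_ite_price y (hmj j)]
    simp only [hf, hμ]
    rw [map_measureReal_apply (hmj j) measurableSet_Ici]
    rfl
  have hitem : ∀ q : Fin k → ℝ≥0, ∑ j, f j (q j) ≤ A.optRevenue D := fun q => by
    obtain ⟨h, hh⟩ := hA.item q
    refine le_trans (le_of_eq ?_) (hle h)
    rw [Mechanism.expRevenue]
    simp only [hh]
    rw [integral_finsetSum]
    · exact Finset.sum_congr rfl fun j _ => hf_eq j (q j)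
    · intro j _
      refine Integrable.of_mem_Icc 0 (q j) (Measurable.ite (measurableSet_le measurable_const
        (hmj j)) measurable_const measurable_const).aemeasurable
        (Filter.Eventually.of_forall fun v => ?_)
      split_ifs <;> simp
  have hf0 : ∀ j y, 0 ≤ f j y := fun j y => mul_nonneg y.coe_nonneg measureReal_nonneg
  have hfbdd : ∀ j, BddAbove (Set.range (f j)) := fun j => ⟨A.optRevenue D, by
    rintro _ ⟨y, rfl⟩
    exact (Finset.single_le_sum (f := fun l => f l y) (fun l _ => hf0 l y)
      (Finset.mem_univ j)).trans (hitem fun _ => y)⟩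
  set r : Fin k → ℝ := fun j => ⨆ y, f j y with hr
  have hfr : ∀ j y, f j y ≤ r j := fun j y => le_ciSup (hfbdd j) y
  -- The suprema need not be attained; prices within η/k of each are combined into one item pricing.
  have hsum : ∑ j, r j ≤ A.optRevenue D := by
    refine le_of_forall_pos_le_add fun η hη => ?_
    have hk' : (0 : ℝ) < k := Nat.cast_pos.2 hk
    have hex : ∀ j, ∃ y, r j - η / k < f j y := fun j =>
      exists_lt_of_lt_ciSup (sub_lt_self _ (by positivity))
    choose q hq using hex
    calc ∑ j, r j ≤ ∑ j, (f j (q j) + η / k) := Finset.sum_le_sum fun j _ => by linarith [hq j]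
      _ = ∑ j, f j (q j) + η := by
          rw [Finset.sum_add_distrib]
          simp only [Finset.sum_const, Finset.card_univ, Fintype.card_fin, nsmul_eq_mul]
          field_simp
      _ ≤ A.optRevenue D + η := by linarith [hitem q]
  have hsummeas : Measurable fun w : Fin k → ℝ≥0 => ∑ j, w j := by fun_prop
  have hB : ∀ y : ℝ≥0, y * (Measure.pi μ).real {w | y ≤ ∑ l, w l} ≤ A.optRevenue D := fun y => by
    obtain ⟨h, hh⟩ := hA.bundle y
    refine le_trans (le_of_eq ?_) (hle h)
    rw [Mechanism.expRevenue]
    simp only [hh]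
    rw [integral_ite_price y (f := fun v : Profile 1 k => ∑ j, v 0 j) (hsummeas.comp hm0), ← hpi,
      map_measureReal_apply hm0 (measurableSet_le measurable_const hsummeas)]
    rfl
  have hle1 : ∀ j, ∀ᵐ y ∂μ j, y ≤ 1 := fun j => by
    rw [hμ, ae_map_iff (hmj j).aemeasurable measurableSet_Iic]
    filter_upwards [hgood] with v hv
    -- The bundle price equal to the buyer's total value earns that value, so unit revenue bounds
    -- all values by 1.
    obtain ⟨h, hh⟩ := hA.bundle (∑ j, v 0 j)
    have h1 := (hv h).2
    rw [hh, if_pos le_rfl] at h1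
    have h2 : ∑ j, v 0 j ≤ 1 := by exact_mod_cast h1
    exact (Finset.single_le_sum (f := fun j => v 0 j) (fun _ _ => zero_le)
      (Finset.mem_univ j)).trans h2
  have hconst : Measurable fun (w : Fin k → ℝ≥0) (_ : Fin 1) => w := by fun_prop
  set p : (Fin k → ℝ≥0) → ℝ := fun w => M.pay (fun _ => w) 0 with hp
  set x : (Fin k → ℝ≥0) → Fin k → ℝ := fun w l => M.alloc (fun _ => w) 0 l with hx
  have hpm : Measurable p := (measurable_pi_apply 0).comp (hpay.comp hconst)
  have hxm : Measurable x := (measurable_pi_apply 0).comp (halloc.comp hconst)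
  have hrev : M.expRevenue D = ∫ w, p w ∂Measure.pi μ := by
    rw [← hpi, integral_map hm0.aemeasurable hpm.aestronglyMeasurable, Mechanism.expRevenue]
    refine integral_congr_ae (Filter.Eventually.of_forall fun v => ?_)
    have hv : (fun _ => v 0) = v := funext fun i => by rw [Subsingleton.elim i 0]
    simp only [Mechanism.revenue, Fin.sum_univ_one, hp, hv]
  rw [hrev]
  have := integral_pay_le (μ := μ) (x := x) (p := p) hk (fun v l => hM.alloc_nonneg _ _ _)
    (fun v l => by
      have := hM.alloc_le_one (fun _ => v) l
      rwa [Fin.sum_univ_one] at this)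
    (fun v w => by
      have := hM.incentive_compatible (fun _ => v) 0 w
      have hw : Function.update (fun _ : Fin 1 => v) 0 w = fun _ => w :=
        funext fun i => by rw [Subsingleton.elim i 0, Function.update_self]
      rwa [hw] at this)
    (fun v => hM.individually_rational (fun _ => v) 0) hxm hpm (r := r) hfr hle1 hB
  linarith

/-- Combines the six-approximation with the counting bound for a double sample of size 2m, whence
log(2m). -/
theorem learnedRevenue_ge_sixth {A : AuctionClass 1 k} (hA : A.ContainsBest) (hT : A.IsTame)
    (hk : 0 < k) {m : ℕ} (hm : 0 < m)
    (hcard : ∀ S : Multiset (Profile 1 k), S.card = 2 * m →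
      (A.onSample S).encard ≤ ((2 * m) ^ (k + 1) : ℕ))
    {erm : Multiset (Profile 1 k) → A.Hyp} (herm : A.IsERM erm)
    {D : ProbabilityMeasure (Profile 1 k)} (hD : D ∈ A.unitRevenue)
    (hind : iIndepFun (fun (j : Fin k) (v : Profile 1 k) => v 0 j) (D : Measure (Profile 1 k)))
    {M : Mechanism 1 k} (hM : M.IsTruthful) (halloc : Measurable M.alloc)
    (hpay : Measurable M.pay) :
    ENNReal.ofReal (1 / 6 * M.expRevenue D) ≤ A.learnedRevenue erm D m +
      ENNReal.ofReal (Real.sqrt (2 * (k + 1) * Real.log (2 * m) / m)) := by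
  have h1 := hA.expRevenue_le hk hD hind hM halloc hpay
  have hN : 2 ≤ (2 * m) ^ (k + 1) :=
    le_trans (by omega) (Nat.le_self_pow (Nat.succ_ne_zero k) (2 * m))
  have h2 := hT.optRevenue_le_of_encard herm hD hm hN hcard
  have h3 : Real.log (((2 * m) ^ (k + 1) : ℕ) : ℝ) = (k + 1) * Real.log (2 * m) := by
    push_cast
    rw [Real.log_pow]
    push_cast
    ring
  rw [h3, ← mul_assoc] at h2
  exact (ENNReal.ofReal_le_ofReal (by linarith)).trans h2

end Benchmark

end

end SplitSample

/-! ### The theorem -/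

open SplitSample in
theorem mainTheorem6 :
    -- ERM prices are sample values
    (∀ (rule : SaleRule) (n k : ℕ), 0 < n → 0 < k →
      (anonymousBundlePricing rule n k).ERMOnSample ∧
      (bundlePricing rule n k).ERMOnSample ∧
      (anonymousItemPricing rule n k).ERMOnSample ∧
      (itemPricing rule n k).ERMOnSample ∧
      (anonymousBestPricing rule n k).ERMOnSample ∧
      (bestPricing rule n k).ERMOnSample) ∧
    -- split-sample growth rates
    (∀ (rule : SaleRule) (n k m : ℕ), 0 < n → 0 < k → 0 < m →
      (anonymousBundlePricing rule n k).GrowthLE m (m * n) ∧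
      (bundlePricing rule n k).GrowthLE m (m ^ n) ∧
      (anonymousItemPricing rule n k).GrowthLE m ((n * m) ^ k) ∧
      (itemPricing rule n k).GrowthLE m (m ^ (n * k)) ∧
      (anonymousBestPricing rule n k).GrowthLE m ((m * n) ^ (k + 1)) ∧
      (bestPricing rule n k).GrowthLE m (m ^ (n * (k + 1)))) ∧
    -- sample complexity, with one constant for all numbers of bidders and items
    (∃ C : ℝ, 0 < C ∧ ∀ (rule : SaleRule) (n k : ℕ), 0 < n → 0 < k →
      ∀ ε : ℝ, 0 < ε → ε ≤ 1 / 2 →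
      (anonymousBundlePricing rule n k).ComplexityLE ε (C * (n * Real.log (1 / ε) / ε ^ 2)) ∧
      (bundlePricing rule n k).ComplexityLE ε (C * (n * Real.log (1 / ε) / ε ^ 2)) ∧
      (anonymousItemPricing rule n k).ComplexityLE ε (C * (n * k * Real.log (1 / ε) / ε ^ 2)) ∧
      (itemPricing rule n k).ComplexityLE ε (C * (n * k * Real.log (1 / ε) / ε ^ 2)) ∧
      (anonymousBestPricing rule n k).ComplexityLE ε
        (C * (n * (k + 1) * Real.log (1 / ε) / ε ^ 2)) ∧
      (bestPricing rule n k).ComplexityLE ε (C * (n * (k + 1) * Real.log (1 / ε) / ε ^ 2))) ∧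
    -- one bidder with independent item values: guarantee against all truthful mechanisms
    (∀ (rule : SaleRule) (k : ℕ), 0 < k →
      ∀ A ∈ ({anonymousBestPricing rule 1 k, bestPricing rule 1 k} : Set (AuctionClass 1 k)),
      ∀ erm, A.IsERM erm →
      ∀ D : ProbabilityMeasure (Profile 1 k), D ∈ A.unitRevenue →
      iIndepFun (fun (j : Fin k) (v : Profile 1 k) => v 0 j) (D : Measure (Profile 1 k)) →
      ∀ M : Mechanism 1 k, M.IsTruthful → Measurable M.alloc → Measurable M.pay →
      ∀ m : ℕ, 0 < m →
        ENNReal.ofReal (1 / 6 * M.expRevenue D) ≤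
          A.learnedRevenue erm D m +
            ENNReal.ofReal (Real.sqrt (2 * (k + 1) * Real.log (2 * m) / m))) := by
  refine ⟨fun rule n k hn hk => ?_, fun rule n k m hn hk hm => ?_,
    ⟨2000000, by norm_num, fun rule n k hn hk ε hε hε2 => ?_⟩,
    fun rule k hk A hA erm herm D hD hind M hM halloc hpay m hm => ?_⟩
  · exact ⟨(isTame_anonymousBundle hn).ermOnSample, isTame_bundle.ermOnSample,
      (isTame_anonymousItem hn).ermOnSample, isTame_item.ermOnSample,
      (isTame_anonymousBest hn).ermOnSample, isTame_best.ermOnSample⟩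
  · refine ⟨(isTame_anonymousBundle hn).growthLE hm ?_, isTame_bundle.growthLE hm ?_,
      (isTame_anonymousItem hn).growthLE hm ?_, isTame_item.growthLE hm ?_,
      growthLE_anonymousBest hn hk hm, growthLE_best hn hk hm⟩
    · rintro S rfl
      exact encard_onSample_anonymousBundle hn S
    · rintro S rfl
      exact encard_onSample_bundle S
    · rintro S rfl
      exact encard_onSample_anonymousItem hn S
    · rintro S rfl
      exact encard_onSample_item S
  · have hn1 : (1 : ℝ) ≤ n := by exact_mod_cast hn
    have hk1 : (1 : ℝ) ≤ k := by exact_mod_cast hk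
    have hbundle : (n * (1 : ℕ) : ℝ) ≤ n := by simp
    have hnk : (1 : ℝ) ≤ n * k := one_le_mul_of_one_le_of_one_le hn1 hk1
    have hsucc : (n * k : ℝ) ≤ n * (k + 1) := by linarith
    have hbundle' : (n * (1 : ℕ) : ℝ) ≤ n * (k + 1) := by
      push_cast
      gcongr
      linarith
    exact ⟨(anonymousBundlePresentation hn).complexityLE hn1 hbundle hε hε2,
      bundlePresentation.complexityLE hn1 hbundle hε hε2,
      (anonymousItemPresentation hn).complexityLE hnk le_rfl hε hε2,
      itemPresentation.complexityLE hnk le_rfl hε hε2,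
      (anonymousBundlePresentation hn).complexityLE_bestOf (anonymousItemPresentation (rule := rule) hn)
        (hnk.trans hsucc) hbundle' hsucc hε hε2,
      bundlePresentation.complexityLE_bestOf (itemPresentation (rule := rule))
        (hnk.trans hsucc) hbundle' hsucc hε hε2⟩
  · rcases hA with rfl | rfl
    · refine learnedRevenue_ge_sixth containsBest_anonymousBest (isTame_anonymousBest one_pos) hk hm
        (fun S hS => ?_) herm hD hind hM halloc hpay
      have := encard_onSample_anonymousBest (rule := rule) one_pos hk (S := S) (by omega)
      rwa [hS, mul_one] at this
    · refine learnedRevenue_ge_sixth containsBest_best isTame_best hk hm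
        (fun S hS => ?_) herm hD hind hM halloc hpay
      have := encard_onSample_best (rule := rule) one_pos hk (S := S) (by omega)
      rwa [hS, one_mul] at this
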